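/- Let $G$ be a discrete group, $H\lhd G$ a finite normal subgroup, $G_0=G/H$, let $\rho:H\to GL(V)$ be an irreducible representation on a finite-dimensional complex vector space such that for every $g\in G$ the representation $\rho_g(h)=\rho(g^{-1}hg)$ is equivalent to $\rho$, and let $F$ be a finite-dimensional complex vector space. Let $u:G\to H$ be any map with $u(gh)=u(g)h$ for $h\in H$ and $u(1)=1$. The canonical model is the $G$-vector bundle $W=G_0\times(F\otimes V)\to G_0$ with the action $$g_1\cdot([g],w)=\bigl([g_1g],\,(\mathrm{id}\otimes\rho(u(g_1g)u(g)^{-1}))\,w\bigr).$$ Let $\mathrm{Aut}_G(W)$ be the group of its $G$-equivariant automorphisms (bijections of $W$ which cover a bijection of $G_0$, are linear isomorphisms on the fibres and commute with $G$), with the topology of pointwise convergence, which is also the compact-open topology. For a space $X$ and a topological group $L$, let $\mathrm{Bundle}(X,L)$ be the category of (locally trivial) principal $L$-bundles over $X$ and their isomorphisms over $\mathrm{id}_X$. For $M\in\mathrm{Bundle}(X,G_0)$, an object of $\mathrm{Vect}_G(M,\rho)$ is a complex vector bundle $\xi\to M$ with a continuous fibrewise linear action of $G$ which covers the action of $G$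 on $M$ through $G_0$ and is quasi-free over the base with normal stationary subgroup $H$ (that is, $G_0$ acts freely on $M$ and, when $\rho$ is nontrivial, $H$ has no fixed points in the total space of $\xi$ outside the zero section), such that there is an $H$-equivariant isomorphism $\xi\cong\xi_0\otimes V$, where $\xi_0\to M$ is a vector bundle with fibre $F$ and trivial action of $H$, and $V$ is the trivial bundle on which $H$ acts fibrewise through $\rho$. Let $$\bigsqcup_{M\in\mathrm{Bundle}(X,G_0)}\mathrm{Vect}_G(M,\rho)$$ be the category whose objects are the pairs $(M,\xi)$ with $M\in\mathrm{Bundle}(X,G_0)$ and $\xi\in\mathrm{Vect}_G(M,\rho)$, and whose morphisms $(M,\xi)\to(M',\xi')$ are the isomorphisms $M\to M'$ of principal bundles over $X$ covered by a $G$-equivariant isomorphism $\xi\to\xi'$ of vector bundles. **Theorem.** If $X$ is compact, there is an equivalence of categories $$\mathrm{Bundle}\bigl(X,\mathrm{Aut}_G(G_0\times(F\otimes V))\bigr)\;\simeq\;\bigsqcup_{M\in\mathrm{Bundle}(X,G_0)}\mathrm{Vect}_G(M,\rho);$$ in particular it is a bijection between isomorphism classes. It sends a principal bundle $P$ to the pair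 $(M,\xi)$ formed by the associated bundles $M=P\times_{\mathrm{Aut}_G(W)}G_0$ and $\xi=P\times_{\mathrm{Aut}_G(W)}W$: there are continuous maps $\varepsilon_P:P\times W\to\xi$ over $X$, natural in $P$, which satisfy $\varepsilon_P(ap,aw)=\varepsilon_P(p,w)$ for $a\in\mathrm{Aut}_G(W)$, are $G$-equivariant in $w\in W$, and for every $p\in P$ map each fibre of $W\to G_0$ by a linear isomorphism onto a fibre of $\xi\to M$. (Principal bundles are written with left actions.) -/

import Mathlib

open CategoryTheory TensorProduct

universe u

/-! ## Principal bundles -/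

/-- A principal `L`-bundle over `X`: a space with a continuous fibrewise left action of the
topological group `L` which is locally isomorphic to `U × L`, where `L` acts by left translations.
(A right action becomes a left action through `p * a = a⁻¹ • p`.) -/
structure PrincipalBundle (L : Type u) [Group L] [TopologicalSpace L]
    (X : Type u) [TopologicalSpace X] where
  /-- the total space -/
  Total : Type u
  [topTotal : TopologicalSpace Total]
  [action : MulAction L Total]
  [continuousAction : ContinuousSMul L Total]
  /-- the projection to the base -/
  proj : Total → X
  proj_smul : ∀ (a : L) (p : Total), proj (a • p) = proj p
  locallyTrivial : ∀ x : X, ∃ e : Bundle.Trivialization L proj, x ∈ e.baseSet ∧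
    ∀ p ∈ e.source, ∀ a : L, (e (a • p)).2 = a * (e p).2

attribute [instance] PrincipalBundle.topTotal PrincipalBundle.action
  PrincipalBundle.continuousAction

namespace PrincipalBundle

variable {L : Type u} [Group L] [TopologicalSpace L] {X : Type u} [TopologicalSpace X]

/-- Morphisms of principal bundles over `X`: continuous equivariant maps over the identity
of `X` (they are automatically isomorphisms). -/
@[ext]
structure Hom (P Q : PrincipalBundle L X) where
  toFun : P.Total → Q.Total
  continuous_toFun : Continuous toFun
  map_smul : ∀ (a : L) (p : P.Total), toFun (a • p) = a • toFun p
  proj_toFun : ∀ p : P.Total, Q.proj (toFun p) = P.proj p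

/-- The category of principal `L`-bundles over `X`. -/
instance : Category (PrincipalBundle L X) where
  Hom := Hom
  id P := ⟨id, continuous_id, fun _ _ => rfl, fun _ => rfl⟩
  comp f g := ⟨g.toFun ∘ f.toFun, g.continuous_toFun.comp f.continuous_toFun,
    fun a p => by simp [f.map_smul, g.map_smul], fun p => by simp [f.proj_toFun, g.proj_toFun]⟩

end PrincipalBundle

/-! ## The canonical model -/

section Model

variable {G : Type u} [Group G]

/-- A map `u : G → H` with `u (g h) = u g * h` for `h ∈ H` and `u 1 = 1`. -/
structure RightRetraction (H : Subgroup G) where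
  toFun : G → H
  map_mul : ∀ (g : G) (h : H), toFun (g * h) = toFun g * h
  map_one : toFun 1 = 1

variable {H : Subgroup G}

/-- `u (g₁ g) * (u g)⁻¹`, as a function of `g₁ ∈ G` and of the coset `[g] ∈ G ⧸ H`. -/
def RightRetraction.cocycle (r : RightRetraction H) (g₁ : G) (c : G ⧸ H) : H :=
  Quotient.liftOn' c (fun g => r.toFun (g₁ * g) * (r.toFun g)⁻¹) (by
    intro a b hab
    obtain ⟨h, rfl⟩ : ∃ h : H, b = a * h :=
      ⟨⟨a⁻¹ * b, QuotientGroup.leftRel_apply.mp hab⟩, by simp⟩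
    simp only [← mul_assoc, r.map_mul]
    group)

theorem RightRetraction.cocycle_mk (r : RightRetraction H) (g₁ g : G) :
    r.cocycle g₁ (g : G ⧸ H) = r.toFun (g₁ * g) * (r.toFun g)⁻¹ := rfl

variable {V : Type u} [NormedAddCommGroup V] [InnerProductSpace ℂ V]

/-- The canonical action of `g₁ ∈ G` on the canonical model `(G ⧸ H) × (F ⊗ V)`:
it maps `([g], w)` to `([g₁ g], (id ⊗ ρ (u (g₁ g) * (u g)⁻¹)) w)`. -/
noncomputable def canonicalAction (r : RightRetraction H) (ρ : Representation ℂ H V)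
    (F : Type u) [NormedAddCommGroup F] [InnerProductSpace ℂ F]
    (g₁ : G) (x : (G ⧸ H) × (F ⊗[ℂ] V)) : (G ⧸ H) × (F ⊗[ℂ] V) :=
  (g₁ • x.1, LinearMap.lTensor F (ρ (r.cocycle g₁ x.1)) x.2)

theorem canonicalAction_one (r : RightRetraction H) (ρ : Representation ℂ H V)
    (F : Type u) [NormedAddCommGroup F] [InnerProductSpace ℂ F] (x : (G ⧸ H) × (F ⊗[ℂ] V)) :
    canonicalAction r ρ F 1 x = x := by
  obtain ⟨c, w⟩ := x
  induction c using QuotientGroup.induction_on with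
  | H g => simp [canonicalAction, RightRetraction.cocycle_mk, Module.End.one_eq_id]

theorem canonicalAction_mul (r : RightRetraction H) (ρ : Representation ℂ H V)
    (F : Type u) [NormedAddCommGroup F] [InnerProductSpace ℂ F]
    (g₁ g₂ : G) (x : (G ⧸ H) × (F ⊗[ℂ] V)) :
    canonicalAction r ρ F (g₁ * g₂) x = canonicalAction r ρ F g₁ (canonicalAction r ρ F g₂ x) := by
  obtain ⟨c, w⟩ := x
  induction c using QuotientGroup.induction_on with
  | H g =>
    simp only [canonicalAction, mul_smul, Prod.mk.injEq, true_and]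
    rw [← LinearMap.comp_apply, ← LinearMap.lTensor_comp, ← Module.End.mul_eq_comp, ← map_mul]
    congr 4
    change _ = r.cocycle g₁ ((g₂ * g : G) : G ⧸ H) * _
    simp [RightRetraction.cocycle_mk, mul_assoc]

/-- The group `Aut_G((G ⧸ H) × (F ⊗ V))` of automorphisms of the canonical model as a vector
`G`-bundle over `G ⧸ H`: bijections which cover a bijection `a` of `G ⧸ H`, are linear
isomorphisms on the fibres, and commute with the canonical action of `G`. -/
noncomputable def AutModel (r : RightRetraction H) (ρ : Representation ℂ H V)
    (F : Type u) [NormedAddCommGroup F] [InnerProductSpace ℂ F] :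
    Subgroup (Equiv.Perm ((G ⧸ H) × (F ⊗[ℂ] V))) where
  carrier := {f | (∃ a : Equiv.Perm (G ⧸ H), ∀ c, ∃ A : (F ⊗[ℂ] V) ≃ₗ[ℂ] (F ⊗[ℂ] V),
      ∀ w, f (c, w) = (a c, A w)) ∧
    ∀ (g : G) (x), f (canonicalAction r ρ F g x) = canonicalAction r ρ F g (f x)}
  one_mem' := ⟨⟨1, fun _ => ⟨LinearEquiv.refl ℂ _, fun _ => rfl⟩⟩, fun _ _ => rfl⟩
  mul_mem' := by
    rintro f f' ⟨⟨a, ha⟩, hf⟩ ⟨⟨a', ha'⟩, hf'⟩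
    refine ⟨⟨a * a', fun c => ?_⟩, fun g x => by simp [hf, hf']⟩
    obtain ⟨A', hA'⟩ := ha' c
    obtain ⟨A, hA⟩ := ha (a' c)
    exact ⟨A'.trans A, fun w => by simp [hA, hA']⟩
  inv_mem' := by
    rintro f ⟨⟨a, ha⟩, hf⟩
    refine ⟨⟨a⁻¹, fun c => ?_⟩, fun g x => ?_⟩
    · obtain ⟨A, hA⟩ := ha (a⁻¹ c)
      exact ⟨A.symm, fun w => by rw [Equiv.Perm.inv_eq_iff_eq, hA]; simp⟩
    · rw [Equiv.Perm.inv_eq_iff_eq, hf]; simp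

/-- The topology of pointwise convergence on `Aut_G((G ⧸ H) × (F ⊗ V))`. As `G ⧸ H` is discrete
and the fibres have finite dimension, it is also the compact-open topology, and the one in which
the kernel `GL(F)` of the projection to `G ⧸ H` is open and carries its usual topology. -/
noncomputable instance AutModel.topology [TopologicalSpace G] (r : RightRetraction H)
    (ρ : Representation ℂ H V) (F : Type u) [NormedAddCommGroup F] [InnerProductSpace ℂ F] :
    TopologicalSpace (AutModel r ρ F) :=
  TopologicalSpace.induced
    (fun a => ((a : Equiv.Perm ((G ⧸ H) × (F ⊗[ℂ] V))) :
      (G ⧸ H) × (F ⊗[ℂ] V) → (G ⧸ H) × (F ⊗[ℂ] V))) inferInstance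

end Model

/-! ## The bundles `ξ = ξ₀ ⊗ V` -/

section EquivariantBundles

open Bundle

variable {G : Type u} [Group G] {H : Subgroup G} [H.Normal]
  {V : Type u} [NormedAddCommGroup V] [InnerProductSpace ℂ V]

/-- An object of `Vect_G(M, ρ)`: a complex vector bundle `ξ` over `M` with a continuous fibrewise
linear action of `G` over the action of `G` on `M`, which is quasi-free over the base with normal
stationary subgroup `H`, and an `H`-equivariant isomorphism `ξ ≅ ξ₀ ⊗ V` for some vector
bundle `ξ₀` with fibre `F` and trivial action of `H`, where `H` acts on the fibre `V` of the
trivial bundle through `ρ`. The action of `G` on `M` is given through `G ⧸ H`. -/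
structure EquivariantBundle (ρ : Representation ℂ H V)
    (F : Type u) [NormedAddCommGroup F] [InnerProductSpace ℂ F]
    (M : Type u) [TopologicalSpace M] [MulAction (G ⧸ H) M] where
  /-- the fibres of `ξ` -/
  E : M → Type u
  [addCommGroup : ∀ m, AddCommGroup (E m)]
  [module : ∀ m, Module ℂ (E m)]
  [topFibre : ∀ m, TopologicalSpace (E m)]
  [topTotal : TopologicalSpace (TotalSpace (F ⊗[ℂ] V) E)]
  [fiberBundle : FiberBundle (F ⊗[ℂ] V) E]
  [vectorBundle : VectorBundle ℂ (F ⊗[ℂ] V) E]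
  [action : MulAction G (TotalSpace (F ⊗[ℂ] V) E)]
  [continuousAction : ContinuousConstSMul G (TotalSpace (F ⊗[ℂ] V) E)]
  /-- each `g` maps the fibre over `m` linearly to the fibre over `[g] m` -/
  linear : ∀ (g : G) (m : M), ∃ A : E m →ₗ[ℂ] E ((g : G ⧸ H) • m),
    ∀ v : E m, g • (⟨m, v⟩ : TotalSpace (F ⊗[ℂ] V) E) = ⟨(g : G ⧸ H) • m, A v⟩
  /-- the action of `G ⧸ H` on the base is free -/
  free : ∀ (c : G ⧸ H) (m : M), c • m = m → c = 1
  /-- for nontrivial `ρ` there are no fixed points of `H` in the total space outside the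
  zero section (for trivial `ρ` every point of `ξ₀ ⊗ V` is fixed) -/
  fixed : (∃ h : H, ρ h ≠ 1) → ∀ (m : M) (v : E m),
    (∀ h : H, (h : G) • (⟨m, v⟩ : TotalSpace (F ⊗[ℂ] V) E) = ⟨m, v⟩) → v = 0
  /-- the isomorphism `τ : ξ₀ ⊗ V ≅ ξ`; as `V` has finite dimension, continuity of `τ` means
  continuity of `e ↦ τ (e ⊗ v)` for all `v` -/
  tensor : ∃ (E₀ : M → Type u) (_ : ∀ m, AddCommGroup (E₀ m)) (_ : ∀ m, Module ℂ (E₀ m))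
    (_ : ∀ m, TopologicalSpace (E₀ m)) (_ : TopologicalSpace (TotalSpace F E₀))
    (_ : FiberBundle F E₀) (_ : VectorBundle ℂ F E₀)
    (τ : ∀ m, (E₀ m ⊗[ℂ] V) ≃ₗ[ℂ] E m),
    (∀ v : V, Continuous fun e : TotalSpace F E₀ =>
      (⟨e.proj, τ e.proj (e.snd ⊗ₜ[ℂ] v)⟩ : TotalSpace (F ⊗[ℂ] V) E)) ∧
    ∀ (h : H) (m : M) (e : E₀ m) (v : V),
      (h : G) • (⟨m, τ m (e ⊗ₜ[ℂ] v)⟩ : TotalSpace (F ⊗[ℂ] V) E) = ⟨m, τ m (e ⊗ₜ[ℂ] ρ h v)⟩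

attribute [instance] EquivariantBundle.addCommGroup EquivariantBundle.module
  EquivariantBundle.topFibre EquivariantBundle.topTotal EquivariantBundle.fiberBundle
  EquivariantBundle.vectorBundle EquivariantBundle.action EquivariantBundle.continuousAction

/-- The total space of `ξ`. -/
abbrev EquivariantBundle.Total {ρ : Representation ℂ H V}
    {F : Type u} [NormedAddCommGroup F] [InnerProductSpace ℂ F]
    {M : Type u} [TopologicalSpace M] [MulAction (G ⧸ H) M]
    (ξ : EquivariantBundle ρ F M) : Type u :=
  TotalSpace (F ⊗[ℂ] V) ξ.E

variable [TopologicalSpace G]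

/-- The disjoint union of the categories `Vect_G(M, ρ)` over all principal `(G ⧸ H)`-bundles
`M → X`: its objects are the pairs of such an `M` and an object of `Vect_G(M, ρ)`. -/
structure BundlePair (ρ : Representation ℂ H V)
    (F : Type u) [NormedAddCommGroup F] [InnerProductSpace ℂ F]
    (X : Type u) [TopologicalSpace X] where
  M : PrincipalBundle (G ⧸ H) X
  ξ : EquivariantBundle ρ F M.Total

namespace BundlePair

variable {ρ : Representation ℂ H V} {F : Type u} [NormedAddCommGroup F] [InnerProductSpace ℂ F]
  {X : Type u} [TopologicalSpace X]

/-- Isomorphisms `(M, ξ) → (M', ξ')`: an isomorphism `M → M'` of principal bundles over `X`,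
covered by a continuous `G`-equivariant map `ξ → ξ'` which is a linear isomorphism on every
fibre. -/
@[ext]
structure Hom (Y Z : BundlePair ρ F X) where
  base : Y.M ⟶ Z.M
  toFun : Y.ξ.Total → Z.ξ.Total
  continuous_toFun : Continuous toFun
  map_smul : ∀ (g : G) (p : Y.ξ.Total), toFun (g • p) = g • toFun p
  linear : ∀ m : Y.M.Total, ∃ A : Y.ξ.E m ≃ₗ[ℂ] Z.ξ.E (base.toFun m),
    ∀ v : Y.ξ.E m, toFun ⟨m, v⟩ = ⟨base.toFun m, A v⟩

/-- The category of pairs `(M, ξ)` and their isomorphisms. -/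
instance : Category (BundlePair ρ F X) where
  Hom := Hom
  id Y := ⟨𝟙 Y.M, id, continuous_id, fun _ _ => rfl, fun _ => ⟨LinearEquiv.refl ℂ _, fun _ => rfl⟩⟩
  comp {Y Z W} f f' := ⟨f.base ≫ f'.base, f'.toFun ∘ f.toFun,
    f'.continuous_toFun.comp f.continuous_toFun,
    fun g p => by simp [f.map_smul, f'.map_smul], fun m => by
      obtain ⟨A, hA⟩ := f.linear m
      obtain ⟨B, hB⟩ := f'.linear (f.base.toFun m)
      exact ⟨A.trans B, fun v => by simp only [Function.comp_apply, hA, hB]; rfl⟩⟩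

end BundlePair

/-- An identification of `ξ → M → X` with the bundle over `X` with fibre the canonical model
`W = (G ⧸ H) × (F ⊗ V)` associated with the principal `Aut_G(W)`-bundle `P`: a continuous map
`P × W → ξ` over `X` which identifies `(a p, a w)` with `(p, w)`, is `G`-equivariant, and for
every `p ∈ P` maps the fibres of `W → G ⧸ H` isomorphically onto fibres of `ξ → M`. -/
structure Association {r : RightRetraction H} {ρ : Representation ℂ H V}
    {F : Type u} [NormedAddCommGroup F] [InnerProductSpace ℂ F]
    {X : Type u} [TopologicalSpace X]
    (P : PrincipalBundle (AutModel r ρ F) X) (Y : BundlePair ρ F X) where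
  toFun : P.Total → (G ⧸ H) × (F ⊗[ℂ] V) → Y.ξ.Total
  continuous_toFun : Continuous fun q : P.Total × ((G ⧸ H) × (F ⊗[ℂ] V)) => toFun q.1 q.2
  smul_smul : ∀ (a : AutModel r ρ F) (p : P.Total) (w : (G ⧸ H) × (F ⊗[ℂ] V)),
    toFun (a • p) ((a : Equiv.Perm ((G ⧸ H) × (F ⊗[ℂ] V))) w) = toFun p w
  equivariant : ∀ (g : G) (p : P.Total) (w : (G ⧸ H) × (F ⊗[ℂ] V)),
    toFun p (canonicalAction r ρ F g w) = g • toFun p w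
  proj_toFun : ∀ (p : P.Total) (w : (G ⧸ H) × (F ⊗[ℂ] V)),
    Y.M.proj (toFun p w).proj = P.proj p
  linear : ∀ (p : P.Total) (c : G ⧸ H), ∃ (m : Y.M.Total) (A : (F ⊗[ℂ] V) ≃ₗ[ℂ] Y.ξ.E m),
    ∀ w : F ⊗[ℂ] V, toFun p (c, w) = ⟨m, A w⟩

end EquivariantBundles

/-!
Write `W = (G ⧸ H) × (F ⊗ V)` for the canonical model and `Aut_G(W)` for its automorphism group.
The equivalence is easiest to describe in the opposite direction. A *frame* of a pair `(M, ξ)` at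
`x : X` is a `G`-equivariant identification of `W` with the part of `ξ` over `x`. Two frames at the
same point differ by a unique element of `Aut_G(W)` (`Frame.exists_aut`), so that the frames, with
the topology of pointwise convergence, form a principal `Aut_G(W)`-bundle as soon as frames exist
locally and depend continuously on the point. This is `BundlePair.exists_local_frame`: over a local
section `σ` of `M` the isomorphism `ξ ≅ ξ₀ ⊗ V` and a local trivialization of `ξ₀` identify `ξ`
with the trivial bundle with fibre `F ⊗ V`, as a bundle with action of `H`, and there is exactly
one way to extend this to a `G`-equivariant identification over the translates of `σ`. All
continuity statements reduce to the finite dimension of `F ⊗ V` and the discreteness of `G ⧸ H`; in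
particular the inversion of `Aut_G(W)` is continuous (`AutModel.continuous_inv`).

The resulting functor `frameFunctor` is faithful, since every point of `ξ` has the form `φ w` for a
frame `φ`, and full, since a morphism `k` of frame bundles induces the well-defined map
`φ w ↦ (k φ) w`. It is essentially surjective, since a principal bundle `P` is the bundle of frames
of the pair of associated bundles `M = P ×_{Aut_G(W)} (G ⧸ H)` and `ξ = P ×_{Aut_G(W)} W`, which
are glued from the transition functions of `P` (`PrincipalBundle.modelPair`). Only here the
hypotheses on `ρ` enter: as `ρ` is equivalent to its conjugates, all fibres of `W` are equivalent to
`F ⊗ V` as representations of `H`, and by Schur's lemma `Aut_G(W)` acts on them, up to these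
equivalences, by maps `B ⊗ id`. The maps `B` form the cocycle of a vector bundle `ξ₀` with
`ξ ≅ ξ₀ ⊗ V` (`Intertwiners.cocycle`).

The maps `ε_P : P × W → ξ` are the evaluations of frames, composed with the unit of the equivalence.
-/

/-! ### Continuity criteria -/

theorem continuousOn_of_discrete_fibres {Z Z' D : Type*} [TopologicalSpace Z] [TopologicalSpace Z']
    [TopologicalSpace D] [DiscreteTopology D] {f : Z → Z'} {q : Z → D} {s : Set Z}
    (hq : ContinuousOn q s) (hf : ∀ d, ContinuousOn f (s ∩ q ⁻¹' {d})) : ContinuousOn f s := by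
  intro z hz
  refine (hf (q z) z ⟨hz, rfl⟩).mono_of_mem_nhdsWithin ?_
  exact Filter.inter_mem self_mem_nhdsWithin (hq z hz ((isOpen_discrete {q z}).mem_nhds rfl))

/-- A map into the total space of a bundle is continuous if its projection to the base is, and its
fibre coordinate is in each trivialization of a family which covers the base. -/
theorem Bundle.Trivialization.continuous_of_comp {B Z T K : Type*} [TopologicalSpace B]
    [TopologicalSpace Z] [TopologicalSpace T] [TopologicalSpace K] {proj : Z → B} {ι : Type*}
    (e : ι → Bundle.Trivialization K proj) (he : ∀ b, ∃ i, b ∈ (e i).baseSet) {f : T → Z}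
    (hf : Continuous fun t => proj (f t))
    (h : ∀ i, ContinuousOn (fun t => (e i (f t)).2) ((fun t => proj (f t)) ⁻¹' (e i).baseSet)) :
    Continuous f := by
  rw [continuous_iff_continuousAt]
  intro t
  obtain ⟨i, hi⟩ := he (proj (f t))
  have hO : (fun t => proj (f t)) ⁻¹' (e i).baseSet ∈ nhds t :=
    ((e i).open_baseSet.preimage hf).mem_nhds hi
  refine (e i).continuousAt_of_comp_left hf.continuousAt hi ?_
  refine ((hf.continuousAt).prodMk ((h i).continuousAt hO)).congr ?_
  filter_upwards [hO] with t' ht'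
  exact Prod.ext ((e i).coe_fst' ht').symm rfl

section LinearFamilies

variable {Z E E' : Type*} [TopologicalSpace Z] [NormedAddCommGroup E] [NormedSpace ℂ E]
  [FiniteDimensional ℂ E] [NormedAddCommGroup E'] [NormedSpace ℂ E']

theorem continuousOn_linearMap_apply {D : Z → E →ₗ[ℂ] E'} {s : Set Z}
    (hD : ∀ w, ContinuousOn (fun z => D z w) s) {g : Z → E} (hg : ContinuousOn g s) :
    ContinuousOn (fun z => D z (g z)) s := by
  have h : ContinuousOn (fun z => LinearMap.toContinuousLinearMap (D z)) s :=
    continuousOn_clm_apply.2 hD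
  exact h.clm_apply hg

/-- The inverses of a pointwise continuous family of automorphisms of a finite-dimensional space
form a continuous family, as inversion is continuous on the units of a Banach algebra. -/
theorem continuousOn_linearEquiv_symm_apply {D : Z → E ≃ₗ[ℂ] E} {s : Set Z}
    (hD : ∀ w, ContinuousOn (fun z => D z w) s) {g : Z → E} (hg : ContinuousOn g s) :
    ContinuousOn (fun z => (D z).symm (g z)) s := by
  have : CompleteSpace E := FiniteDimensional.complete ℂ E
  have h : ContinuousOn (fun z => LinearMap.toContinuousLinearMap (D z : E →ₗ[ℂ] E)) s :=
    continuousOn_clm_apply.2 hD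
  let U : Z → (E →L[ℂ] E)ˣ := fun z =>
    ⟨LinearMap.toContinuousLinearMap (D z : E →ₗ[ℂ] E),
      LinearMap.toContinuousLinearMap ((D z).symm : E →ₗ[ℂ] E),
      by ext; simp, by ext; simp⟩
  have h' : ContinuousOn (fun z => LinearMap.toContinuousLinearMap ((D z).symm : E →ₗ[ℂ] E)) s := by
    intro z hz
    have := ContinuousAt.comp_continuousWithinAt
      (f := fun z => LinearMap.toContinuousLinearMap (D z : E →ₗ[ℂ] E))
      (NormedRing.inverse_continuousAt (U z)) (h z hz)
    refine this.congr (fun y _ => ?_) ?_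
    · exact (Ring.inverse_unit (U y)).symm
    · exact (Ring.inverse_unit (U z)).symm
  exact h'.clm_apply hg

/-- Continuity on a tensor product may be checked on pure tensors. -/
theorem continuousOn_tensor_of_tmul {F V : Type*} [AddCommGroup F] [Module ℂ F] [AddCommGroup V]
    [Module ℂ V] {D : Z → F ⊗[ℂ] V →ₗ[ℂ] E'} {s : Set Z}
    (hD : ∀ f v, ContinuousOn (fun z => D z (f ⊗ₜ v)) s) (w : F ⊗[ℂ] V) :
    ContinuousOn (fun z => D z w) s := by
  induction w using TensorProduct.induction_on with
  | zero => simpa using continuousOn_const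
  | tmul f v => exact hD f v
  | add x y hx hy =>
    simp only [map_add]
    exact hx.add hy

end LinearFamilies

/-! ### Automorphisms of the canonical model -/

section Model

variable {G : Type u} [Group G] {H : Subgroup G} {V : Type u} [NormedAddCommGroup V]
  [InnerProductSpace ℂ V] {r : RightRetraction H} {ρ : Representation ℂ H V}
  {F : Type u} [NormedAddCommGroup F] [InnerProductSpace ℂ F]

namespace AutModel

/-- The bijection of `G ⧸ H` covered by an automorphism of the canonical model. -/
noncomputable def base (a : AutModel r ρ F) : Equiv.Perm (G ⧸ H) := a.2.1.choose

/-- The linear isomorphism from the fibre over `c` to the fibre over `base a c` given by an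
automorphism `a` of the canonical model. -/
noncomputable def lin (a : AutModel r ρ F) (c : G ⧸ H) : (F ⊗[ℂ] V) ≃ₗ[ℂ] (F ⊗[ℂ] V) :=
  (a.2.1.choose_spec c).choose

theorem apply_mk (a : AutModel r ρ F) (c : G ⧸ H) (w : F ⊗[ℂ] V) :
    (a : Equiv.Perm ((G ⧸ H) × (F ⊗[ℂ] V))) (c, w) = (base a c, lin a c w) :=
  (a.2.1.choose_spec c).choose_spec w

theorem apply_eq (a : AutModel r ρ F) (x : (G ⧸ H) × (F ⊗[ℂ] V)) :
    (a : Equiv.Perm ((G ⧸ H) × (F ⊗[ℂ] V))) x = (base a x.1, lin a x.1 x.2) :=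
  apply_mk a x.1 x.2

theorem apply_canonicalAction (a : AutModel r ρ F) (g : G) (x : (G ⧸ H) × (F ⊗[ℂ] V)) :
    (a : Equiv.Perm ((G ⧸ H) × (F ⊗[ℂ] V))) (canonicalAction r ρ F g x) =
      canonicalAction r ρ F g ((a : Equiv.Perm ((G ⧸ H) × (F ⊗[ℂ] V))) x) :=
  a.2.2 g x

theorem base_smul (a : AutModel r ρ F) (g : G) (c : G ⧸ H) : base a (g • c) = g • base a c := by
  have h := congrArg Prod.fst (apply_canonicalAction a g (c, 0))
  simpa [canonicalAction, apply_mk] using h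

/-- `a` intertwines the linear parts of the canonical action. -/
theorem lin_lTensor (a : AutModel r ρ F) (g : G) (c : G ⧸ H) (w : F ⊗[ℂ] V) :
    lin a (g • c) (LinearMap.lTensor F (ρ (r.cocycle g c)) w) =
      LinearMap.lTensor F (ρ (r.cocycle g (base a c))) (lin a c w) := by
  have h := congrArg Prod.snd (apply_canonicalAction a g (c, w))
  simpa [canonicalAction, apply_mk] using h

theorem base_one (c : G ⧸ H) : base (1 : AutModel r ρ F) c = c :=
  (congrArg Prod.fst (apply_mk (1 : AutModel r ρ F) c 0)).symm

theorem lin_one (c : G ⧸ H) (w : F ⊗[ℂ] V) : lin (1 : AutModel r ρ F) c w = w :=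
  (congrArg Prod.snd (apply_mk (1 : AutModel r ρ F) c w)).symm

theorem mul_apply_mk (a b : AutModel r ρ F) (c : G ⧸ H) (w : F ⊗[ℂ] V) :
    (base (a * b) c, lin (a * b) c w) = (base a (base b c), lin a (base b c) (lin b c w)) := by
  rw [← apply_mk, ← apply_mk, ← apply_mk]
  rfl

theorem base_mul (a b : AutModel r ρ F) (c : G ⧸ H) : base (a * b) c = base a (base b c) :=
  congrArg Prod.fst (mul_apply_mk a b c 0)

theorem lin_mul (a b : AutModel r ρ F) (c : G ⧸ H) (w : F ⊗[ℂ] V) :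
    lin (a * b) c w = lin a (base b c) (lin b c w) :=
  congrArg Prod.snd (mul_apply_mk a b c w)

theorem base_inv (a : AutModel r ρ F) (c : G ⧸ H) : base a⁻¹ c = (base a).symm c := by
  rw [Equiv.eq_symm_apply, ← base_mul, mul_inv_cancel, base_one]

theorem lin_inv (a : AutModel r ρ F) (c : G ⧸ H) (w : F ⊗[ℂ] V) :
    lin a⁻¹ c w = (lin a (base a⁻¹ c)).symm w := by
  rw [LinearEquiv.eq_symm_apply, ← lin_mul, mul_inv_cancel, lin_one]

/-- A bijection of `G ⧸ H` which commutes with left translations is a right translation. -/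
theorem base_eq_mul [H.Normal] (a : AutModel r ρ F) (c : G ⧸ H) : base a c = c * base a 1 := by
  induction c using QuotientGroup.induction_on with
  | H g =>
    have h := base_smul a g 1
    have h1 : g • (1 : G ⧸ H) = (g : G ⧸ H) := by
      change ((g * 1 : G) : G ⧸ H) = _
      rw [mul_one]
    rw [h1] at h
    rw [h]
    exact QuotientGroup.induction_on (base a 1) fun _ => rfl

theorem base_inv_eq_mul [H.Normal] (a : AutModel r ρ F) (c : G ⧸ H) :
    base a⁻¹ c = c * (base a 1)⁻¹ := by
  rw [base_inv, Equiv.symm_apply_eq, base_eq_mul]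
  simp

variable [TopologicalSpace G]

theorem continuous_eval (x : (G ⧸ H) × (F ⊗[ℂ] V)) :
    Continuous fun a : AutModel r ρ F => (a : Equiv.Perm ((G ⧸ H) × (F ⊗[ℂ] V))) x :=
  (continuous_apply x).comp continuous_induced_dom

theorem continuousOn_iff {Z : Type*} [TopologicalSpace Z] {f : Z → AutModel r ρ F} {s : Set Z} :
    ContinuousOn f s ↔
      ∀ x, ContinuousOn (fun z => (f z : Equiv.Perm ((G ⧸ H) × (F ⊗[ℂ] V))) x) s := by
  simp only [continuousOn_iff_continuous_domRestrict]
  rw [continuous_induced_rng, continuous_pi_iff]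
  rfl

theorem continuous_base (c : G ⧸ H) : Continuous fun a : AutModel r ρ F => base a c := by
  have h := continuous_fst.comp (continuous_eval (r := r) (ρ := ρ) (F := F) (c, 0))
  simpa [Function.comp_def, apply_mk] using h

theorem continuous_lin (c : G ⧸ H) (w : F ⊗[ℂ] V) :
    Continuous fun a : AutModel r ρ F => lin a c w := by
  have h := continuous_snd.comp (continuous_eval (r := r) (ρ := ρ) (F := F) (c, w))
  simpa [Function.comp_def, apply_mk] using h

variable [DiscreteTopology G]

theorem discreteTopology_quotient (H : Subgroup G) : DiscreteTopology (G ⧸ H) :=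
  discreteTopology_iff_forall_isOpen.2 fun _ =>
    isQuotientMap_quot_mk.isOpen_preimage.1 (isOpen_discrete _)

attribute [local instance] discreteTopology_quotient

variable [FiniteDimensional ℂ V] [FiniteDimensional ℂ F]

theorem continuous_apply_prod :
    Continuous fun q : AutModel r ρ F × ((G ⧸ H) × (F ⊗[ℂ] V)) =>
      (q.1 : Equiv.Perm ((G ⧸ H) × (F ⊗[ℂ] V))) q.2 := by
  have h : Continuous fun q : (G ⧸ H) × (AutModel r ρ F × (F ⊗[ℂ] V)) =>
      (base q.2.1 q.1, lin q.2.1 q.1 q.2.2) := by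
    refine continuous_prod_of_discrete_left.2 fun c => ?_
    refine ((continuous_base c).comp continuous_fst).prodMk ?_
    rw [← continuousOn_univ]
    exact continuousOn_linearMap_apply (D := fun q : AutModel r ρ F × (F ⊗[ℂ] V) =>
        (lin q.1 c : (F ⊗[ℂ] V) →ₗ[ℂ] F ⊗[ℂ] V))
      (fun w => ((continuous_lin c w).comp continuous_fst).continuousOn) continuous_snd.continuousOn
  have h' := h.comp (f := fun q : AutModel r ρ F × ((G ⧸ H) × (F ⊗[ℂ] V)) =>
    (q.2.1, (q.1, q.2.2))) (by fun_prop)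
  simpa [Function.comp_def, apply_eq] using h'

theorem continuousOn_apply {Z : Type*} [TopologicalSpace Z] {f : Z → AutModel r ρ F}
    {x : Z → (G ⧸ H) × (F ⊗[ℂ] V)} {s : Set Z} (hf : ContinuousOn f s) (hx : ContinuousOn x s) :
    ContinuousOn (fun z => (f z : Equiv.Perm ((G ⧸ H) × (F ⊗[ℂ] V))) (x z)) s :=
  continuous_apply_prod.comp_continuousOn (hf.prodMk hx)

/-- Near a given automorphism the base map is constant, so that the inversion is, fibre by fibre,
the inversion of linear isomorphisms. -/
theorem continuous_inv [H.Normal] : Continuous fun a : AutModel r ρ F => a⁻¹ := by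
  rw [← continuousOn_univ, continuousOn_iff]
  rintro ⟨c, w⟩
  rw [continuousOn_univ, continuous_iff_continuousAt]
  intro a₀
  have hb : ∀ᶠ a : AutModel r ρ F in nhds a₀, base a 1 = base a₀ 1 :=
    (continuous_base 1).continuousAt.eventually (IsOpen.mem_nhds (isOpen_discrete {base a₀ 1}) rfl)
  have hlin : Continuous fun a : AutModel r ρ F => (lin a (base a₀⁻¹ c)).symm w := by
    rw [← continuousOn_univ]
    exact continuousOn_linearEquiv_symm_apply (fun w => (continuous_lin _ w).continuousOn)
      continuousOn_const
  have h : Continuous fun a : AutModel r ρ F => (base a₀⁻¹ c, (lin a (base a₀⁻¹ c)).symm w) :=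
    continuous_const.prodMk hlin
  refine h.continuousAt.congr (hb.mono fun a ha => ?_)
  have : base a⁻¹ c = base a₀⁻¹ c := by rw [base_inv_eq_mul, base_inv_eq_mul, ha]
  simp only [apply_mk, lin_inv, this]

theorem continuousOn_inv [H.Normal] {Z : Type*} [TopologicalSpace Z] {f : Z → AutModel r ρ F}
    {s : Set Z} (hf : ContinuousOn f s) : ContinuousOn (fun z => (f z)⁻¹) s :=
  continuous_inv.comp_continuousOn hf

end AutModel
end Model

/-! ### Local sections of principal bundles -/

namespace PrincipalBundle

variable {L : Type u} [Group L] [TopologicalSpace L] {X : Type u} [TopologicalSpace X]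
  (P : PrincipalBundle L X)

/-- A chosen equivariant local trivialization around `x`. -/
noncomputable def chart (x : X) : Bundle.Trivialization L P.proj := (P.locallyTrivial x).choose

theorem mem_chart (x : X) : x ∈ (P.chart x).baseSet := (P.locallyTrivial x).choose_spec.1

/-- The fibre coordinate in the chosen trivialization around `x`. -/
noncomputable def coord (x : X) (p : P.Total) : L := (P.chart x p).2

/-- The local section of `P` given by `1` in the chosen trivialization around `x`. -/
noncomputable def sec (x y : X) : P.Total := (P.chart x).toOpenPartialHomeomorph.symm (y, 1)

variable {P} {x y : X}

theorem coord_smul {p : P.Total} (hp : P.proj p ∈ (P.chart x).baseSet) (a : L) :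
    P.coord x (a • p) = a * P.coord x p :=
  (P.locallyTrivial x).choose_spec.2 p ((P.chart x).mem_source.2 hp) a

theorem proj_sec (hy : y ∈ (P.chart x).baseSet) : P.proj (P.sec x y) = y :=
  (P.chart x).proj_symm_apply' hy

theorem coord_sec (hy : y ∈ (P.chart x).baseSet) : P.coord x (P.sec x y) = 1 :=
  congrArg Prod.snd ((P.chart x).apply_symm_apply' hy)

theorem eq_of_coord_eq {p q : P.Total} (hp : P.proj p ∈ (P.chart x).baseSet)
    (hpq : P.proj p = P.proj q) (h : P.coord x p = P.coord x q) : p = q := by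
  have hq : P.proj q ∈ (P.chart x).baseSet := hpq ▸ hp
  refine (P.chart x).injOn ((P.chart x).mem_source.2 hp) ((P.chart x).mem_source.2 hq) ?_
  refine Prod.ext ?_ h
  exact ((P.chart x).coe_fst' hp).trans (hpq.trans ((P.chart x).coe_fst' hq).symm)

theorem coord_smul_sec {p : P.Total} (hp : P.proj p ∈ (P.chart x).baseSet) :
    P.coord x p • P.sec x (P.proj p) = p := by
  have h : P.proj (P.sec x (P.proj p)) ∈ (P.chart x).baseSet := by rwa [proj_sec hp]
  refine eq_of_coord_eq (x := x) ?_ ?_ ?_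
  · rwa [P.proj_smul]
  · rw [P.proj_smul, proj_sec hp]
  · rw [coord_smul h, coord_sec hp, mul_one]

theorem continuousOn_sec : ContinuousOn (P.sec x) (P.chart x).baseSet :=
  (P.chart x).toOpenPartialHomeomorph.continuousOn_symm.comp
    (continuousOn_id.prodMk continuousOn_const) fun _ hy => (P.chart x).mem_target.2 hy

theorem continuousOn_coord :
    ContinuousOn (P.coord x) (P.proj ⁻¹' (P.chart x).baseSet) := by
  rw [← (P.chart x).source_eq]
  exact continuous_snd.comp_continuousOn (P.chart x).continuousOn_toFun

theorem continuous_proj : Continuous P.proj := by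
  rw [continuous_iff_continuousAt]
  exact fun p => (P.chart (P.proj p)).continuousAt_proj
    ((P.chart (P.proj p)).mem_source.2 (P.mem_chart _))

theorem smul_right_cancel {a b : L} {p : P.Total} (h : a • p = b • p) : a = b := by
  have h' := congrArg (P.coord (P.proj p)) h
  rwa [coord_smul (P.mem_chart _), coord_smul (P.mem_chart _), mul_left_inj] at h'

theorem exists_smul_eq {p q : P.Total} (h : P.proj p = P.proj q) : ∃ a : L, a • p = q := by
  refine ⟨P.coord (P.proj p) q * (P.coord (P.proj p) p)⁻¹,
    eq_of_coord_eq (x := P.proj p) ?_ ?_ ?_⟩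
  · rw [P.proj_smul]
    exact P.mem_chart _
  · rw [P.proj_smul, h]
  · rw [coord_smul (P.mem_chart _), inv_mul_cancel_right]

end PrincipalBundle

/-! ### Frames -/

section Frames

open Bundle

variable {G : Type u} [Group G] {H : Subgroup G} [H.Normal]
  {V : Type u} [NormedAddCommGroup V] [InnerProductSpace ℂ V]
  {ρ : Representation ℂ H V} {F : Type u} [NormedAddCommGroup F] [InnerProductSpace ℂ F]

theorem EquivariantBundle.proj_smul {M : Type u} [TopologicalSpace M] [MulAction (G ⧸ H) M]
    (ξ : EquivariantBundle ρ F M) (g : G) (z : ξ.Total) :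
    (g • z).proj = (g : G ⧸ H) • z.proj := by
  obtain ⟨A, hA⟩ := ξ.linear g z.proj
  exact congrArg TotalSpace.proj (hA z.2)

theorem smul_eq_mk_mul (g : G) (c : G ⧸ H) : g • c = (g : G ⧸ H) * c :=
  QuotientGroup.induction_on c fun _ => rfl

variable [TopologicalSpace G] {X : Type u} [TopologicalSpace X]

/-- A frame of `ξ → M → X` at a point of `X`: an equivariant identification of the canonical model
with the part of `ξ` over this point. -/
@[ext]
structure Frame (r : RightRetraction H) (Y : BundlePair ρ F X) where
  toFun : (G ⧸ H) × (F ⊗[ℂ] V) → Y.ξ.Total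
  equivariant : ∀ (g : G) (w : (G ⧸ H) × (F ⊗[ℂ] V)),
    toFun (canonicalAction r ρ F g w) = g • toFun w
  /-- a frame lies over a single point of `X` -/
  proj_eq : ∀ w, Y.M.proj (toFun w).proj = Y.M.proj (toFun (1, 0)).proj
  linear : ∀ c : G ⧸ H, ∃ (m : Y.M.Total) (A : (F ⊗[ℂ] V) ≃ₗ[ℂ] Y.ξ.E m),
    ∀ w : F ⊗[ℂ] V, toFun (c, w) = ⟨m, A w⟩

namespace Frame

variable {r : RightRetraction H} {Y : BundlePair ρ F X}

/-- The map `G ⧸ H → M` covered by a frame. -/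
def base (φ : Frame r Y) (c : G ⧸ H) : Y.M.Total := (φ.toFun (c, 0)).proj

/-- The point of `X` over which a frame lives. -/
def point (φ : Frame r Y) : X := Y.M.proj (φ.base 1)

theorem proj_toFun (φ : Frame r Y) (w : (G ⧸ H) × (F ⊗[ℂ] V)) :
    (φ.toFun w).proj = φ.base w.1 := by
  obtain ⟨c, w⟩ := w
  obtain ⟨m, A, h⟩ := φ.linear c
  rw [base, h, h]

theorem proj_proj_toFun (φ : Frame r Y) (w : (G ⧸ H) × (F ⊗[ℂ] V)) :
    Y.M.proj (φ.toFun w).proj = φ.point :=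
  φ.proj_eq w

theorem exists_lin (φ : Frame r Y) {c : G ⧸ H} {m : Y.M.Total} (hm : φ.base c = m) :
    ∃ A : (F ⊗[ℂ] V) ≃ₗ[ℂ] Y.ξ.E m, ∀ w : F ⊗[ℂ] V, φ.toFun (c, w) = ⟨m, A w⟩ := by
  obtain ⟨m', A, h⟩ := φ.linear c
  obtain rfl : m = m' := hm.symm.trans (congrArg TotalSpace.proj (h 0))
  exact ⟨A, h⟩

theorem base_eq (φ : Frame r Y) (c : G ⧸ H) : φ.base c = c • φ.base 1 := by
  induction c using QuotientGroup.induction_on with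
  | H g =>
    have h := congrArg TotalSpace.proj (φ.equivariant g (1, 0))
    rw [EquivariantBundle.proj_smul] at h
    simpa [canonicalAction, smul_eq_mk_mul, base] using h

theorem base_injective (φ : Frame r Y) : Function.Injective φ.base := by
  intro c d h
  rw [φ.base_eq c, φ.base_eq d] at h
  exact PrincipalBundle.smul_right_cancel h

theorem injective (φ : Frame r Y) : Function.Injective φ.toFun := by
  rintro ⟨c, v⟩ ⟨d, w⟩ h
  have hcd := congrArg TotalSpace.proj h
  rw [φ.proj_toFun, φ.proj_toFun] at hcd
  obtain rfl := φ.base_injective hcd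
  obtain ⟨A, hA⟩ := φ.exists_lin (c := c) rfl
  rw [hA, hA] at h
  have := A.injective (TotalSpace.mk_inj.1 h)
  rw [this]

theorem exists_base_eq (φ : Frame r Y) {m : Y.M.Total} (h : Y.M.proj m = φ.point) :
    ∃ c, φ.base c = m := by
  obtain ⟨c, hc⟩ := PrincipalBundle.exists_smul_eq (p := φ.base 1) (q := m) h.symm
  exact ⟨c, (φ.base_eq c).trans hc⟩

theorem exists_eq (φ : Frame r Y) {z : Y.ξ.Total} (h : Y.M.proj z.proj = φ.point) :
    ∃ w, φ.toFun w = z := by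
  obtain ⟨m, v⟩ := z
  obtain ⟨c, rfl⟩ := φ.exists_base_eq h
  obtain ⟨A, hA⟩ := φ.exists_lin (c := c) rfl
  exact ⟨(c, A.symm v), by rw [hA, A.apply_symm_apply]⟩

/-- Two frames at the same point differ by an automorphism of the canonical model. -/
theorem exists_aut (φ ψ : Frame r Y) (h : φ.point = ψ.point) :
    ∃ a : AutModel r ρ F, ∀ w,
      φ.toFun w = ψ.toFun ((a : Equiv.Perm ((G ⧸ H) × (F ⊗[ℂ] V))) w) := by
  have h1 : ∀ w, ∃ w', ψ.toFun w' = φ.toFun w := fun w =>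
    ψ.exists_eq ((φ.proj_proj_toFun w).trans h)
  have h2 : ∀ w, ∃ w', φ.toFun w' = ψ.toFun w := fun w =>
    φ.exists_eq ((ψ.proj_proj_toFun w).trans h.symm)
  choose f hf using h1
  choose k hk using h2
  let e : Equiv.Perm ((G ⧸ H) × (F ⊗[ℂ] V)) :=
    ⟨f, k, fun w => φ.injective (by rw [hk, hf]), fun w => ψ.injective (by rw [hf, hk])⟩
  have he : ∀ w, ψ.toFun (e w) = φ.toFun w := hf
  refine ⟨⟨e, ?_, fun g w => ?_⟩, fun w => (he w).symm⟩
  · obtain ⟨d, hd⟩ := ψ.exists_base_eq (m := φ.base 1) h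
    refine ⟨Equiv.mulRight d, fun c => ?_⟩
    have hcd : φ.base c = ψ.base (c * d) := by
      rw [φ.base_eq, ← hd, ψ.base_eq d, ψ.base_eq (c * d), mul_smul]
    obtain ⟨A, hA⟩ := φ.exists_lin (c := c) rfl
    obtain ⟨B, hB⟩ := ψ.exists_lin hcd.symm
    exact ⟨A.trans B.symm, fun w => ψ.injective (by simp [he, hA, hB])⟩
  · apply ψ.injective
    rw [he, ψ.equivariant, he, φ.equivariant]

end Frame

end Frames

/-! ### Local frames -/

section LocalFrames

open Bundle

variable {G : Type u} [Group G] {H : Subgroup G} [H.Normal]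
  {V : Type u} [NormedAddCommGroup V] [InnerProductSpace ℂ V]
  {ρ : Representation ℂ H V} {F : Type u} [NormedAddCommGroup F] [InnerProductSpace ℂ F]

theorem EquivariantBundle.exists_linearEquiv {M : Type u} [TopologicalSpace M]
    [MulAction (G ⧸ H) M] (ξ : EquivariantBundle ρ F M) (g : G) (m : M) :
    ∃ A : ξ.E m ≃ₗ[ℂ] ξ.E ((g : G ⧸ H) • m),
      ∀ v : ξ.E m, g • (⟨m, v⟩ : ξ.Total) = ⟨(g : G ⧸ H) • m, A v⟩ := by
  obtain ⟨A, hA⟩ := ξ.linear g m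
  refine ⟨LinearEquiv.ofBijective A ⟨fun v w hvw => ?_, fun w => ?_⟩, hA⟩
  · have h : g • (⟨m, v⟩ : ξ.Total) = g • ⟨m, w⟩ := by rw [hA, hA, hvw]
    exact TotalSpace.mk_inj.1 (MulAction.injective g h)
  · obtain ⟨v, hv⟩ : ∃ v : ξ.E m, (⟨m, v⟩ : ξ.Total) = g⁻¹ • ⟨(g : G ⧸ H) • m, w⟩ := by
      have h : (g⁻¹ • (⟨(g : G ⧸ H) • m, w⟩ : ξ.Total)).proj = m := by
        rw [ξ.proj_smul, QuotientGroup.mk_inv, inv_smul_smul]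
      generalize g⁻¹ • (⟨(g : G ⧸ H) • m, w⟩ : ξ.Total) = z at h
      subst h
      exact ⟨z.2, rfl⟩
    refine ⟨v, ?_⟩
    have h := hA v
    rw [hv, smul_inv_smul] at h
    exact (TotalSpace.mk_inj.1 h).symm

/-- Locally over `M`, the bundle `ξ` is `H`-equivariantly trivial with fibre `F ⊗ V`: the map `j`
is such a trivialization and `k` is the fibre coordinate in it. -/
theorem EquivariantBundle.exists_equivariant_trivialization [FiniteDimensional ℂ V]
    [FiniteDimensional ℂ F] {M : Type u} [TopologicalSpace M]
    [MulAction (G ⧸ H) M] (ξ : EquivariantBundle ρ F M) (m₀ : M) :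
    ∃ (N : Set M) (j : M → F ⊗[ℂ] V → ξ.Total) (k : ξ.Total → F ⊗[ℂ] V),
      IsOpen N ∧ m₀ ∈ N ∧
      ContinuousOn (fun q : M × (F ⊗[ℂ] V) => j q.1 q.2) (N ×ˢ Set.univ) ∧
      ContinuousOn k (TotalSpace.proj ⁻¹' N) ∧
      (∀ z : ξ.Total, z.proj ∈ N → j z.proj (k z) = z) ∧
      (∀ m ∈ N, ∃ J : (F ⊗[ℂ] V) ≃ₗ[ℂ] ξ.E m, ∀ w, j m w = ⟨m, J w⟩) ∧
      ∀ m ∈ N, ∀ (h : H) (w : F ⊗[ℂ] V), (h : G) • j m w = j m (LinearMap.lTensor F (ρ h) w) := by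
  obtain ⟨E₀, i₁, i₂, i₃, i₄, i₅, i₆, τ, hτ, hτH⟩ := ξ.tensor
  let e₀ := trivializationAt F E₀ m₀
  let e₁ := trivializationAt (F ⊗[ℂ] V) ξ.E m₀
  let N : Set M := e₀.baseSet ∩ e₁.baseSet
  -- `D m` is the transition from the trivialization `e₀ ⊗ id` of `ξ₀ ⊗ V` to the trivialization
  -- `e₁` of `ξ`. It is continuous on pure tensors, hence continuous together with its inverse.
  have hJ : ∀ m ∈ N, ∃ J : (F ⊗[ℂ] V) ≃ₗ[ℂ] ξ.E m,
      ∀ f v, J (f ⊗ₜ v) = τ m (e₀.symm m f ⊗ₜ v) := fun m hm =>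
    ⟨(TensorProduct.congr (e₀.linearEquivAt ℂ m hm.1).symm (LinearEquiv.refl ℂ V)).trans (τ m),
      fun f v => rfl⟩
  have hD : ∀ m, ∃ D : (F ⊗[ℂ] V) ≃ₗ[ℂ] (F ⊗[ℂ] V), m ∈ N →
      ∀ f v, D (f ⊗ₜ v) = (e₁ ⟨m, τ m (e₀.symm m f ⊗ₜ v)⟩).2 := by
    intro m
    by_cases hm : m ∈ N
    · obtain ⟨J, hJ⟩ := hJ m hm
      refine ⟨J.trans (e₁.linearEquivAt ℂ m hm.2), fun _ f v => ?_⟩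
      rw [LinearEquiv.trans_apply, hJ]
      rfl
    · exact ⟨LinearEquiv.refl ℂ _, fun h => absurd h hm⟩
  choose D hD using hD
  have hJD : ∀ m ∈ N, ∃ J : (F ⊗[ℂ] V) ≃ₗ[ℂ] ξ.E m,
      (∀ f v, J (f ⊗ₜ v) = τ m (e₀.symm m f ⊗ₜ v)) ∧
      ∀ w, (⟨m, e₁.symm m (D m w)⟩ : ξ.Total) = ⟨m, J w⟩ := by
    intro m hm
    obtain ⟨J, hJ⟩ := hJ m hm
    refine ⟨J, hJ, fun w => ?_⟩
    have h : ∀ w, D m w = e₁.linearEquivAt ℂ m hm.2 (J w) := by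
      intro w
      induction w using TensorProduct.induction_on with
      | zero => simp only [map_zero]
      | tmul f v => rw [hD m hm, hJ]; rfl
      | add x y hx hy => simp only [map_add, hx, hy]
    rw [h]
    exact congrArg _ ((e₁.linearEquivAt ℂ m hm.2).symm_apply_apply (J w))
  have hDc : ∀ w, ContinuousOn (fun m => D m w) N := by
    refine continuousOn_tensor_of_tmul (D := fun m => (D m : (F ⊗[ℂ] V) →ₗ[ℂ] F ⊗[ℂ] V))
      fun f v => ?_
    have h1 : ContinuousOn (fun m => (⟨m, e₀.symm m f⟩ : TotalSpace F E₀)) N := by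
      refine (e₀.continuousOn_symm.comp (f := fun m => (m, f))
        (continuousOn_id.prodMk continuousOn_const) fun m hm => ⟨hm.1, trivial⟩).congr
        fun m _ => rfl
    have h2 := continuous_snd.comp_continuousOn (e₁.continuousOn_toFun.comp
      ((hτ v).comp_continuousOn h1) fun m hm => e₁.mem_source.2 hm.2)
    exact h2.congr fun m hm => hD m hm f v
  refine ⟨N, fun m w => ⟨m, e₁.symm m (D m w)⟩, fun z => (D z.proj).symm (e₁ z).2,
    e₀.open_baseSet.inter e₁.open_baseSet,
    ⟨mem_baseSet_trivializationAt F E₀ m₀, mem_baseSet_trivializationAt _ ξ.E m₀⟩,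
    ?_, ?_, fun z hz => ?_, fun m hm => ?_, fun m hm h w => ?_⟩
  · have h : ContinuousOn (fun q : M × (F ⊗[ℂ] V) => (q.1, D q.1 q.2)) (N ×ˢ Set.univ) :=
      continuous_fst.continuousOn.prodMk (continuousOn_linearMap_apply
        (D := fun q : M × (F ⊗[ℂ] V) => (D q.1 : (F ⊗[ℂ] V) →ₗ[ℂ] F ⊗[ℂ] V))
        (fun w => (hDc w).comp continuous_fst.continuousOn fun q hq => hq.1)
        continuous_snd.continuousOn)
    exact e₁.continuousOn_symm.comp h fun q hq => ⟨hq.1.2, trivial⟩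
  · refine continuousOn_linearEquiv_symm_apply (D := fun z : ξ.Total => D z.proj)
      (fun w => (hDc w).comp (FiberBundle.continuous_proj _ ξ.E).continuousOn fun z hz => hz) ?_
    exact continuous_snd.comp_continuousOn (e₁.continuousOn_toFun.mono fun z hz =>
      e₁.mem_source.2 hz.2)
  · simp only [LinearEquiv.apply_symm_apply]
    exact e₁.symm_proj_apply z hz.2 ▸ rfl
  · obtain ⟨J, -, h⟩ := hJD m hm
    exact ⟨J, h⟩
  · obtain ⟨J, hJ, h'⟩ := hJD m hm
    obtain ⟨A, hA⟩ := ξ.linear h m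
    have hm1 : ((h : G) : G ⧸ H) • m = m := by
      rw [(QuotientGroup.eq_one_iff (h : G)).2 h.2, one_smul]
    -- The action of `h` preserves the fibre over `m`, so that both sides are linear in `w`.
    obtain ⟨B, hB⟩ : ∃ B : ξ.E m →ₗ[ℂ] ξ.E m,
        ∀ v : ξ.E m, (h : G) • (⟨m, v⟩ : ξ.Total) = ⟨m, B v⟩ := by
      generalize ((h : G) : G ⧸ H) • m = m' at A hA hm1
      subst hm1
      exact ⟨A, hA⟩
    change (h : G) • (⟨m, e₁.symm m (D m w)⟩ : ξ.Total) = ⟨m, e₁.symm m (D m _)⟩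
    rw [h', h', hB]
    congr 1
    induction w using TensorProduct.induction_on with
    | zero => simp
    | tmul f v =>
      have h2 := hτH h m (e₀.symm m f) v
      rw [hB] at h2
      rw [LinearMap.lTensor_tmul, hJ, hJ]
      exact TotalSpace.mk_inj.1 h2
    | add x y hx hy => simp only [map_add, hx, hy]

variable [TopologicalSpace G] [DiscreteTopology G] {X : Type u} [TopologicalSpace X]
  [FiniteDimensional ℂ V] [FiniteDimensional ℂ F]

attribute [local instance] AutModel.discreteTopology_quotient

/-- Locally over `X` the bundle `ξ → M → X` is equivariantly trivial with fibre the canonical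
model: the frames `s y` depend continuously on `y`, and so do the coordinates `t` in them. -/
theorem BundlePair.exists_local_frame (r : RightRetraction H) (Y : BundlePair ρ F X) (x : X) :
    ∃ (U : Set X) (s : X → (G ⧸ H) × (F ⊗[ℂ] V) → Y.ξ.Total)
      (t : Y.ξ.Total → (G ⧸ H) × (F ⊗[ℂ] V)),
      IsOpen U ∧ x ∈ U ∧
      (∀ y ∈ U, ∃ φ : Frame r Y, φ.point = y ∧ φ.toFun = s y) ∧
      ContinuousOn (fun q : X × ((G ⧸ H) × (F ⊗[ℂ] V)) => s q.1 q.2) (U ×ˢ Set.univ) ∧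
      ContinuousOn t ((fun z => Y.M.proj z.proj) ⁻¹' U) ∧
      ∀ z : Y.ξ.Total, Y.M.proj z.proj ∈ U → s (Y.M.proj z.proj) (t z) = z := by
  let σ := Y.M.sec x
  obtain ⟨N, j, k, hN, hxN, hj, hk, hjk, hlin, hequiv⟩ :=
    Y.ξ.exists_equivariant_trivialization (σ x)
  let U := (Y.M.chart x).baseSet ∩ σ ⁻¹' N
  -- In the canonical model `([g], w) = g • ([1], (id ⊗ ρ (u g)⁻¹) w)`, so that an equivariant map
  -- which is `j (σ y)` over `[1]` has to be given by the following formula, for any choice of `g`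
  -- in the coset (`hs` below).
  let s : X → (G ⧸ H) × (F ⊗[ℂ] V) → Y.ξ.Total := fun y w =>
    w.1.out • j (σ y) (LinearMap.lTensor F (ρ (r.toFun w.1.out)⁻¹) w.2)
  let t : Y.ξ.Total → (G ⧸ H) × (F ⊗[ℂ] V) := fun z =>
    (Y.M.coord x z.proj, LinearMap.lTensor F (ρ (r.toFun (Y.M.coord x z.proj).out))
      (k ((Y.M.coord x z.proj).out⁻¹ • z)))
  have hout : ∀ c : G ⧸ H, ((c.out : G) : G ⧸ H) = c := QuotientGroup.out_eq'
  have hρ : ∀ (h₁ h₂ : H) (w : F ⊗[ℂ] V),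
      LinearMap.lTensor F (ρ h₁) (LinearMap.lTensor F (ρ h₂) w) =
        LinearMap.lTensor F (ρ (h₁ * h₂)) w := by
    intro h₁ h₂ w
    rw [map_mul, Module.End.mul_eq_comp, LinearMap.lTensor_comp, LinearMap.comp_apply]
  have hρ1 : ∀ w : F ⊗[ℂ] V, LinearMap.lTensor F (ρ 1) w = w := by
    intro w
    rw [map_one, Module.End.one_eq_id, LinearMap.lTensor_id, LinearMap.id_apply]
  have hs : ∀ y ∈ U, ∀ (g : G) (w : F ⊗[ℂ] V),
      s y ((g : G ⧸ H), w) = g • j (σ y) (LinearMap.lTensor F (ρ (r.toFun g)⁻¹) w) := by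
    intro y hy g w
    obtain ⟨h, hh⟩ := QuotientGroup.mk_out_eq_mul H g
    change (g : G ⧸ H).out • j (σ y) (LinearMap.lTensor F (ρ (r.toFun (g : G ⧸ H).out)⁻¹) w) = _
    rw [hh, r.map_mul, mul_smul, hequiv _ hy.2, hρ, mul_inv_rev, mul_inv_cancel_left]
  have hproj : ∀ y ∈ U, ∀ w, (s y w).proj = w.1 • σ y := by
    rintro y hy ⟨c, w⟩
    obtain ⟨J, hJ⟩ := hlin _ hy.2
    change (c.out • j (σ y) _).proj = _
    rw [Y.ξ.proj_smul, hout, hJ]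
  have hpp : ∀ y ∈ U, ∀ w, Y.M.proj (s y w).proj = y := by
    intro y hy w
    rw [hproj y hy, Y.M.proj_smul, PrincipalBundle.proj_sec hy.1]
  have hshift : ∀ z : Y.ξ.Total, Y.M.proj z.proj ∈ U →
      ((Y.M.coord x z.proj).out⁻¹ • z).proj = σ (Y.M.proj z.proj) := by
    intro z hz
    rw [Y.ξ.proj_smul, QuotientGroup.mk_inv, hout]
    nth_rw 2 [← PrincipalBundle.coord_smul_sec hz.1]
    rw [inv_smul_smul]
  refine ⟨U, s, t, ?_, ⟨Y.M.mem_chart x, hxN⟩, fun y hy => ?_, ?_, ?_, fun z hz => ?_⟩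
  · exact PrincipalBundle.continuousOn_sec.isOpen_inter_preimage (Y.M.chart x).open_baseSet hN
  · refine ⟨⟨s y, fun g => ?_, fun w => ?_, fun c => ?_⟩, hpp y hy _, rfl⟩
    · rintro ⟨c, w⟩
      induction c using QuotientGroup.induction_on with
      | H g' =>
        rw [hs y hy, canonicalAction, RightRetraction.cocycle_mk]
        change s y (((g * g' : G) : G ⧸ H), _) = _
        rw [hs y hy, hρ, inv_mul_cancel_left, mul_smul]
    · rw [hpp y hy, hpp y hy]
    · obtain ⟨J, hJ⟩ := hlin _ hy.2
      obtain ⟨A, hA⟩ := Y.ξ.exists_linearEquiv c.out (σ y)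
      let R : (F ⊗[ℂ] V) ≃ₗ[ℂ] (F ⊗[ℂ] V) :=
        { LinearMap.lTensor F (ρ (r.toFun c.out)⁻¹) with
          invFun := LinearMap.lTensor F (ρ (r.toFun c.out))
          left_inv := fun w => by
            change LinearMap.lTensor F _ (LinearMap.lTensor F _ w) = w
            rw [hρ, mul_inv_cancel, hρ1]
          right_inv := fun w => by
            change LinearMap.lTensor F _ (LinearMap.lTensor F _ w) = w
            rw [hρ, inv_mul_cancel, hρ1] }
      refine ⟨_, (R.trans J).trans A, fun w => ?_⟩
      change c.out • j (σ y) _ = _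
      rw [hJ, hA]
      rfl
  · refine continuousOn_of_discrete_fibres (q := fun q => q.2.1) (by fun_prop) fun c => ?_
    have h : ContinuousOn (fun q : X × ((G ⧸ H) × (F ⊗[ℂ] V)) =>
        c.out • j (σ q.1) (LinearMap.lTensor F (ρ (r.toFun c.out)⁻¹) q.2.2))
        (U ×ˢ Set.univ ∩ (fun q => q.2.1) ⁻¹' {c}) := by
      refine (continuous_const_smul c.out).comp_continuousOn (hj.comp (f := fun q : X × ((G ⧸ H) ×
        (F ⊗[ℂ] V)) => (σ q.1, LinearMap.lTensor F (ρ (r.toFun c.out)⁻¹) q.2.2)) ?_ ?_)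
      · refine ContinuousOn.prodMk ?_ ?_
        · exact PrincipalBundle.continuousOn_sec.comp continuous_fst.continuousOn
            fun q hq => hq.1.1.1
        · exact ((LinearMap.continuous_of_finiteDimensional _).comp
            (continuous_snd.comp continuous_snd)).continuousOn
      · exact fun q hq => ⟨hq.1.1.2, trivial⟩
    refine h.congr ?_
    rintro ⟨y, c', w⟩ ⟨-, rfl⟩
    rfl
  · have hc : ContinuousOn (fun z : Y.ξ.Total => Y.M.coord x z.proj)
        ((fun z => Y.M.proj z.proj) ⁻¹' U) :=
      PrincipalBundle.continuousOn_coord.comp (FiberBundle.continuous_proj _ Y.ξ.E).continuousOn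
        fun z hz => hz.1
    refine hc.prodMk (continuousOn_of_discrete_fibres hc fun c => ?_)
    have h : ContinuousOn (fun z : Y.ξ.Total => LinearMap.lTensor F (ρ (r.toFun c.out))
        (k (c.out⁻¹ • z)))
        ((fun z => Y.M.proj z.proj) ⁻¹' U ∩ (fun z => Y.M.coord x z.proj) ⁻¹' {c}) := by
      refine (LinearMap.continuous_of_finiteDimensional _).comp_continuousOn
        (hk.comp (continuous_const_smul c.out⁻¹).continuousOn ?_)
      rintro z ⟨hz, rfl⟩
      change (_ • z).proj ∈ N
      rw [hshift z hz]
      exact hz.2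
    refine h.congr ?_
    rintro z ⟨-, rfl⟩
    rfl
  · change (Y.M.coord x z.proj).out • j (σ (Y.M.proj z.proj)) (LinearMap.lTensor F _
      (LinearMap.lTensor F _ (k ((Y.M.coord x z.proj).out⁻¹ • z)))) = z
    rw [hρ, inv_mul_cancel, hρ1, ← hshift z hz, hjk _ (hshift z hz ▸ hz.2), smul_inv_smul]

end LocalFrames

/-! ### The bundle of frames -/

section FrameBundle

open Bundle

variable {G : Type u} [Group G] {H : Subgroup G} [H.Normal]
  {V : Type u} [NormedAddCommGroup V] [InnerProductSpace ℂ V] [TopologicalSpace G]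
  {ρ : Representation ℂ H V} {F : Type u} [NormedAddCommGroup F] [InnerProductSpace ℂ F]
  {X : Type u} [TopologicalSpace X] {r : RightRetraction H}

namespace BundlePair

variable {Y Z : BundlePair ρ F X}

theorem Hom.proj_toFun (f : Y ⟶ Z) (z : Y.ξ.Total) : (f.toFun z).proj = f.base.toFun z.proj := by
  obtain ⟨A, hA⟩ := f.linear z.proj
  exact congrArg TotalSpace.proj (hA z.2)

theorem Hom.ext_toFun {f g : Y ⟶ Z} (h : ∀ z, f.toFun z = g.toFun z) : f = g := by
  refine Hom.ext (PrincipalBundle.Hom.ext (funext fun m => ?_)) (funext h)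
  have h' := congrArg TotalSpace.proj (h ⟨m, 0⟩)
  rwa [Hom.proj_toFun, Hom.proj_toFun] at h'

end BundlePair

namespace Frame

variable {Y Z : BundlePair ρ F X}

/-- Frames carry the topology of pointwise convergence. -/
instance : TopologicalSpace (Frame r Y) := TopologicalSpace.induced Frame.toFun inferInstance

theorem continuous_eval (w : (G ⧸ H) × (F ⊗[ℂ] V)) :
    Continuous fun φ : Frame r Y => φ.toFun w :=
  (continuous_apply w).comp continuous_induced_dom

theorem continuousOn_iff {T : Type*} [TopologicalSpace T] {f : T → Frame r Y} {s : Set T} :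
    ContinuousOn f s ↔ ∀ w, ContinuousOn (fun z => (f z).toFun w) s := by
  simp only [continuousOn_iff_continuous_domRestrict]
  rw [continuous_induced_rng, continuous_pi_iff]
  rfl

theorem continuous_point : Continuous (Frame.point : Frame r Y → X) :=
  (PrincipalBundle.continuous_proj.comp (FiberBundle.continuous_proj _ Y.ξ.E)).comp
    (continuous_eval (1, 0))

noncomputable instance : SMul (AutModel r ρ F) (Frame r Y) where
  smul a φ :=
    { toFun := fun w => φ.toFun ((a⁻¹ : AutModel r ρ F).1 w)
      equivariant := fun g w => by rw [AutModel.apply_canonicalAction, φ.equivariant]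
      proj_eq := fun w => by rw [φ.proj_eq, φ.proj_eq ((a⁻¹ : AutModel r ρ F).1 (1, 0))]
      linear := fun c => by
        obtain ⟨m, A, hA⟩ := φ.linear (AutModel.base a⁻¹ c)
        exact ⟨m, (AutModel.lin a⁻¹ c).trans A, fun w => by rw [AutModel.apply_mk, hA]; rfl⟩ }

theorem smul_toFun (a : AutModel r ρ F) (φ : Frame r Y) (w : (G ⧸ H) × (F ⊗[ℂ] V)) :
    (a • φ).toFun w = φ.toFun ((a⁻¹ : AutModel r ρ F).1 w) := rfl

/-- An automorphism of the canonical model acts on frames by precomposition with its inverse. -/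
noncomputable instance : MulAction (AutModel r ρ F) (Frame r Y) where
  one_smul φ := Frame.ext (funext fun w => by rw [smul_toFun, inv_one]; rfl)
  mul_smul a b φ := Frame.ext (funext fun w => by
    rw [smul_toFun, smul_toFun, smul_toFun, mul_inv_rev]; rfl)

theorem smul_toFun_apply (a : AutModel r ρ F) (φ : Frame r Y) (w : (G ⧸ H) × (F ⊗[ℂ] V)) :
    (a • φ).toFun (a.1 w) = φ.toFun w := by
  rw [smul_toFun]
  exact congrArg φ.toFun (a.1.symm_apply_apply w)

theorem point_smul (a : AutModel r ρ F) (φ : Frame r Y) : (a • φ).point = φ.point :=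
  φ.proj_proj_toFun _

theorem smul_right_cancel {a b : AutModel r ρ F} {φ : Frame r Y} (h : a • φ = b • φ) : a = b := by
  rw [← inv_inj]
  refine Subtype.ext (Equiv.ext fun w => φ.injective ?_)
  exact congrFun (congrArg Frame.toFun h) w

theorem exists_smul_eq (φ ψ : Frame r Y) (h : φ.point = ψ.point) :
    ∃ a : AutModel r ρ F, a • φ = ψ := by
  obtain ⟨a, ha⟩ := φ.exists_aut ψ h
  refine ⟨a, Frame.ext (funext fun w => ?_)⟩
  rw [smul_toFun, ha]
  exact congrArg ψ.toFun (a.1.apply_symm_apply w)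

/-- The frame of `Z` obtained from a frame of `Y` and an isomorphism from `Y` to `Z`. -/
def map (f : Y ⟶ Z) (φ : Frame r Y) : Frame r Z where
  toFun w := f.toFun (φ.toFun w)
  equivariant g w := by rw [φ.equivariant, f.map_smul]
  proj_eq w := by
    rw [BundlePair.Hom.proj_toFun, BundlePair.Hom.proj_toFun, f.base.proj_toFun,
      f.base.proj_toFun, φ.proj_eq]
  linear c := by
    obtain ⟨m, A, hA⟩ := φ.linear c
    obtain ⟨B, hB⟩ := f.linear m
    exact ⟨_, A.trans B, fun w => by rw [hA, hB]; rfl⟩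

theorem point_map (f : Y ⟶ Z) (φ : Frame r Y) : (φ.map f).point = φ.point := by
  change Z.M.proj (f.toFun _).proj = Y.M.proj _
  rw [BundlePair.Hom.proj_toFun, f.base.proj_toFun]
  rfl

theorem continuous_map (f : Y ⟶ Z) : Continuous (Frame.map f : Frame r Y → Frame r Z) := by
  rw [← continuousOn_univ, continuousOn_iff]
  exact fun w => (f.continuous_toFun.comp (continuous_eval w)).continuousOn

variable [DiscreteTopology G] [FiniteDimensional ℂ V] [FiniteDimensional ℂ F]

theorem exists_point_eq (r : RightRetraction H) (Y : BundlePair ρ F X) (x : X) :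
    ∃ φ : Frame r Y, φ.point = x := by
  obtain ⟨U, s, t, -, hx, hφ, -⟩ := Y.exists_local_frame r x
  obtain ⟨φ, h, -⟩ := hφ x hx
  exact ⟨φ, h⟩

/-- The local triviality of the bundle of frames: there are local sections `S`, the coordinate `A`
of a frame in the local section, and the coordinate `t` of a point of `ξ` in it. -/
theorem exists_section (r : RightRetraction H) (Y : BundlePair ρ F X) (x : X) :
    ∃ (U : Set X) (S : X → Frame r Y) (A : Frame r Y → AutModel r ρ F)
      (t : Y.ξ.Total → (G ⧸ H) × (F ⊗[ℂ] V)),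
      IsOpen U ∧ x ∈ U ∧ (∀ y, (S y).point = y) ∧ (∀ φ, A φ • S φ.point = φ) ∧
      ContinuousOn (fun q : X × ((G ⧸ H) × (F ⊗[ℂ] V)) => (S q.1).toFun q.2) (U ×ˢ Set.univ) ∧
      ContinuousOn A (Frame.point ⁻¹' U) ∧
      ContinuousOn t ((fun z => Y.M.proj z.proj) ⁻¹' U) ∧
      ∀ z : Y.ξ.Total, Y.M.proj z.proj ∈ U → (S (Y.M.proj z.proj)).toFun (t z) = z := by
  obtain ⟨U, s, t, hU, hx, hφ, hs, ht, hst⟩ := Y.exists_local_frame r x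
  have hS : ∀ y, ∃ φ : Frame r Y, φ.point = y ∧ (y ∈ U → φ.toFun = s y) := by
    intro y
    by_cases hy : y ∈ U
    · obtain ⟨φ, h, h'⟩ := hφ y hy
      exact ⟨φ, h, fun _ => h'⟩
    · obtain ⟨φ, h⟩ := exists_point_eq r Y y
      exact ⟨φ, h, fun h => absurd h hy⟩
  choose S hSp hSs using hS
  have hA : ∀ φ : Frame r Y, ∃ a : AutModel r ρ F, a • S φ.point = φ := fun φ =>
    exists_smul_eq _ _ (hSp _)
  choose A hA using hA
  have hSt : ∀ z : Y.ξ.Total, Y.M.proj z.proj ∈ U → (S (Y.M.proj z.proj)).toFun (t z) = z :=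
    fun z hz => by rw [hSs _ hz, hst z hz]
  refine ⟨U, S, A, t, hU, hx, hSp, hA, ?_, ?_, ht, hSt⟩
  · exact hs.congr fun q hq => by rw [hSs _ hq.1]
  -- The inverse of `A φ` maps `w` to the coordinate `t (φ w)`.
  · have h : ContinuousOn (fun φ => (A φ)⁻¹) (Frame.point ⁻¹' U) := by
      rw [AutModel.continuousOn_iff]
      intro w
      refine (ht.comp (continuous_eval w).continuousOn fun φ hφ => ?_).congr fun φ hφ => ?_
      · change Y.M.proj (φ.toFun w).proj ∈ U
        rwa [proj_proj_toFun]
      · apply (S φ.point).injective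
        have h1 := hSt (φ.toFun w) (by rwa [proj_proj_toFun])
        rw [proj_proj_toFun] at h1
        rw [Function.comp_apply, h1, ← smul_toFun, hA]
    exact (AutModel.continuousOn_inv h).congr fun φ _ => (inv_inv (A φ)).symm

theorem continuous_toFun_prod : Continuous fun q : Frame r Y × ((G ⧸ H) × (F ⊗[ℂ] V)) =>
    q.1.toFun q.2 := by
  rw [continuous_iff_continuousAt]
  rintro ⟨φ₀, w₀⟩
  obtain ⟨U, S, A, t, hU, hx, -, hA, hS, hAc, -⟩ := exists_section r Y φ₀.point
  have hO : IsOpen ((Frame.point ⁻¹' U : Set (Frame r Y)) ×ˢ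
      (Set.univ : Set ((G ⧸ H) × (F ⊗[ℂ] V)))) :=
    (hU.preimage continuous_point).prod isOpen_univ
  refine ContinuousOn.continuousAt ?_ (hO.mem_nhds ⟨hx, trivial⟩)
  have h1 : ContinuousOn (fun q : Frame r Y × ((G ⧸ H) × (F ⊗[ℂ] V)) =>
      ((A q.1)⁻¹ : AutModel r ρ F).1 q.2) ((Frame.point ⁻¹' U) ×ˢ Set.univ) :=
    AutModel.continuousOn_apply (AutModel.continuousOn_inv (hAc.comp continuous_fst.continuousOn
      fun q hq => hq.1)) continuous_snd.continuousOn
  refine (hS.comp ((continuous_point.comp continuous_fst).continuousOn.prodMk h1)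
    fun q hq => ⟨hq.1, trivial⟩).congr fun q hq => ?_
  conv_lhs => rw [← hA q.1]
  rfl

theorem continuousOn_smul {T : Type*} [TopologicalSpace T] {f : T → AutModel r ρ F}
    {k : T → Frame r Y} {s : Set T} (hf : ContinuousOn f s)
    (hk : ContinuousOn (fun q : T × ((G ⧸ H) × (F ⊗[ℂ] V)) => (k q.1).toFun q.2) (s ×ˢ Set.univ)) :
    ContinuousOn (fun q => f q • k q) s := by
  rw [continuousOn_iff]
  intro w
  exact hk.comp (continuousOn_id.prodMk
    (AutModel.continuousOn_iff.1 (AutModel.continuousOn_inv hf) w)) fun q hq => ⟨hq, trivial⟩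

instance : ContinuousSMul (AutModel r ρ F) (Frame r Y) where
  continuous_smul := by
    rw [← continuousOn_univ]
    exact continuousOn_smul continuous_fst.continuousOn (continuous_toFun_prod.comp
      ((continuous_snd.comp continuous_fst).prodMk continuous_snd)).continuousOn

end Frame

variable [DiscreteTopology G] [FiniteDimensional ℂ V] [FiniteDimensional ℂ F]

/-- The principal bundle over `X` of all frames of a pair `(M, ξ)`. -/
noncomputable def frameBundle (r : RightRetraction H) (Y : BundlePair ρ F X) :
    PrincipalBundle (AutModel r ρ F) X where
  Total := Frame r Y
  proj := Frame.point
  proj_smul := Frame.point_smul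
  locallyTrivial x := by
    obtain ⟨U, S, A, t, hU, hx, hSp, hA, hS, hAc, -⟩ := Frame.exists_section r Y x
    -- The trivialization sends a frame `φ` to the unique `A φ` with `A φ • S y = φ`.
    have hAa : ∀ (a : AutModel r ρ F) (φ : Frame r Y), A (a • φ) = a * A φ := by
      intro a φ
      apply Frame.smul_right_cancel (φ := S φ.point)
      have h := hA (a • φ)
      rw [Frame.point_smul] at h
      rw [h, mul_smul, hA]
    have hAS : ∀ y, A (S y) = 1 := by
      intro y
      apply Frame.smul_right_cancel (φ := S y)
      have h := hA (S y)
      rw [hSp] at h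
      rw [h, one_smul]
    refine ⟨
      { toFun := fun φ => (φ.point, A φ)
        invFun := fun q => q.2 • S q.1
        source := Frame.point ⁻¹' U
        target := U ×ˢ Set.univ
        map_source' := fun φ hφ => ⟨hφ, trivial⟩
        map_target' := fun q hq => by
          rw [Set.mem_preimage, Frame.point_smul, hSp]
          exact hq.1
        left_inv' := fun φ _ => hA φ
        right_inv' := fun q _ => by
          rw [Frame.point_smul, hSp, hAa, hAS, mul_one]
        open_source := hU.preimage Frame.continuous_point
        open_target := hU.prod isOpen_univ
        continuousOn_toFun := Frame.continuous_point.continuousOn.prodMk hAc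
        continuousOn_invFun := Frame.continuousOn_smul continuous_snd.continuousOn
          (hS.comp ((continuous_fst.comp continuous_fst).prodMk continuous_snd).continuousOn
            fun q hq => ⟨hq.1.1, trivial⟩)
        baseSet := U
        open_baseSet := hU
        source_eq := rfl
        target_eq := rfl
        proj_toFun := fun _ _ => rfl }, hx, fun φ _ a => hAa a φ⟩

/-- The functor which sends a pair `(M, ξ)` to its bundle of frames. -/
noncomputable def frameFunctor (r : RightRetraction H) (ρ : Representation ℂ H V)
    (F : Type u) [NormedAddCommGroup F] [InnerProductSpace ℂ F] [FiniteDimensional ℂ F]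
    (X : Type u) [TopologicalSpace X] :
    BundlePair ρ F X ⥤ PrincipalBundle (AutModel r ρ F) X where
  obj Y := frameBundle r Y
  map f := ⟨Frame.map f, Frame.continuous_map f, fun _ _ => rfl, Frame.point_map f⟩
  map_id _ := rfl
  map_comp _ _ := rfl

instance faithful_frameFunctor : (frameFunctor r ρ F X).Faithful where
  map_injective {Y Z f g} h := by
    refine BundlePair.Hom.ext_toFun fun z => ?_
    obtain ⟨φ, hφ⟩ := Frame.exists_point_eq r Y (Y.M.proj z.proj)
    obtain ⟨w, rfl⟩ := φ.exists_eq hφ.symm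
    exact congrFun (congrArg Frame.toFun (congrFun (congrArg PrincipalBundle.Hom.toFun h) φ)) w

/-- A morphism `k` of frame bundles comes from the map `φ w ↦ (k φ) w`. -/
instance full_frameFunctor : (frameFunctor r ρ F X).Full where
  map_surjective {Y Z} k := by
    let κ : Frame r Y → Frame r Z := k.toFun
    have hκc : Continuous κ := k.continuous_toFun
    have hκs : ∀ (a : AutModel r ρ F) (φ : Frame r Y), κ (a • φ) = a • κ φ := k.map_smul
    have hκp : ∀ φ, (κ φ).point = φ.point := k.proj_toFun
    -- Another frame at the same point has the form `a • φ`, and `a` cancels by equivariance of `k`.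
    have h : ∀ z : Y.ξ.Total, ∃ z' : Z.ξ.Total, ∀ (φ : Frame r Y) (w), φ.toFun w = z →
        (κ φ).toFun w = z' := by
      intro z
      obtain ⟨φ, hφ⟩ := Frame.exists_point_eq r Y (Y.M.proj z.proj)
      obtain ⟨w, rfl⟩ := φ.exists_eq hφ.symm
      refine ⟨(κ φ).toFun w, fun ψ w' h => ?_⟩
      have hψ := congrArg (fun z => Y.M.proj z.proj) h
      simp only [Frame.proj_proj_toFun] at hψ
      obtain ⟨a, rfl⟩ := Frame.exists_smul_eq φ ψ hψ.symm
      obtain rfl := φ.injective h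
      rw [hκs]
      rfl
    choose f hf using h
    have hfφ : ∀ (φ : Frame r Y) (w), f (φ.toFun w) = (κ φ).toFun w := fun φ w =>
      (hf _ φ w rfl).symm
    have hcont : Continuous f := by
      rw [continuous_iff_continuousAt]
      intro z₀
      obtain ⟨U, S, A, t, hU, hx, hSp, hA, hS, hAc, htc, hSt⟩ :=
        Frame.exists_section r Y (Y.M.proj z₀.proj)
      have hpr : Continuous fun z : Y.ξ.Total => Y.M.proj z.proj :=
        PrincipalBundle.continuous_proj.comp (FiberBundle.continuous_proj _ Y.ξ.E)
      refine ContinuousOn.continuousAt ?_ ((hU.preimage hpr).mem_nhds hx)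
      have hSc : ContinuousOn S U := Frame.continuousOn_iff.2 fun w =>
        hS.comp (continuousOn_id.prodMk continuousOn_const) fun y hy => ⟨hy, trivial⟩
      refine (Frame.continuous_toFun_prod.comp_continuousOn
        ((hκc.comp_continuousOn (hSc.comp hpr.continuousOn fun z hz => hz)).prodMk htc)).congr
        fun z hz => ?_
      conv_lhs => rw [← hSt z hz, hfφ]
      rfl
    have hrep : ∀ z : Y.ξ.Total, ∃ (φ : Frame r Y) (w : _), φ.toFun w = z := by
      intro z
      obtain ⟨φ, hφ⟩ := Frame.exists_point_eq r Y (Y.M.proj z.proj)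
      exact ⟨φ, φ.exists_eq hφ.symm⟩
    have hbase : ∀ (φ : Frame r Y) (c : G ⧸ H), (f ⟨φ.base c, 0⟩).proj = (κ φ).base c := by
      intro φ c
      obtain ⟨A, hA⟩ := φ.exists_lin (c := c) rfl
      have h0 := hA 0
      rw [map_zero] at h0
      rw [← h0, hfφ]
      rfl
    have hrep' : ∀ m : Y.M.Total, ∃ (φ : Frame r Y) (c : _), φ.base c = m := by
      intro m
      obtain ⟨φ, hφ⟩ := Frame.exists_point_eq r Y (Y.M.proj m)
      exact ⟨φ, φ.exists_base_eq hφ.symm⟩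
    let β : Y.M ⟶ Z.M :=
      { toFun := fun m => (f ⟨m, 0⟩).proj
        continuous_toFun := (FiberBundle.continuous_proj _ Z.ξ.E).comp
          (hcont.comp (Bundle.Trivialization.continuous_zeroSection ℂ))
        map_smul := fun d m => by
          obtain ⟨φ, c, rfl⟩ := hrep' m
          have h : d • φ.base c = φ.base (d * c) := by
            rw [φ.base_eq c, φ.base_eq (d * c), mul_smul]
          rw [h, hbase, hbase, (κ φ).base_eq c, (κ φ).base_eq (d * c), mul_smul]
        proj_toFun := fun m => by
          obtain ⟨φ, c, rfl⟩ := hrep' m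
          rw [hbase]
          exact ((κ φ).proj_proj_toFun (c, 0)).trans ((hκp φ).trans
            (φ.proj_proj_toFun (c, 0)).symm) }
    refine ⟨⟨β, f, hcont, fun g z => ?_, fun m => ?_⟩, ?_⟩
    · obtain ⟨φ, w, rfl⟩ := hrep z
      rw [← φ.equivariant, hfφ, hfφ, (κ φ).equivariant]
    · obtain ⟨φ, c, rfl⟩ := hrep' m
      obtain ⟨A, hA⟩ := φ.exists_lin (c := c) rfl
      obtain ⟨B, hB⟩ := (κ φ).exists_lin (c := c) (hbase φ c).symm
      refine ⟨A.symm.trans B, fun v => ?_⟩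
      have h := hA (A.symm v)
      rw [A.apply_symm_apply] at h
      rw [← h, hfφ, hB]
      rfl
    · exact PrincipalBundle.Hom.ext (funext fun φ => Frame.ext (funext fun w => hfφ φ w))

end FrameBundle

/-! ### Intertwiners and Schur's lemma -/

theorem TensorProduct.eq_zero_of_forall_dual {F V : Type*} [AddCommGroup F] [Module ℂ F]
    [AddCommGroup V] [Module ℂ V] {w : F ⊗[ℂ] V}
    (h : ∀ μ : F →ₗ[ℂ] ℂ, TensorProduct.lid ℂ V (LinearMap.rTensor V μ w) = 0) : w = 0 := by
  classical
  let b := Module.Basis.ofVectorSpace ℂ F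
  apply (TensorProduct.equivFinsuppOfBasisLeft (N := V) b).injective
  rw [map_zero]
  refine Finsupp.ext fun i => ?_
  rw [TensorProduct.equivFinsuppOfBasisLeft_apply]
  exact h (b.coord i)

theorem TensorProduct.lid_rTensor_lTensor {F V : Type*} [AddCommGroup F] [Module ℂ F]
    [AddCommGroup V] [Module ℂ V] (μ : F →ₗ[ℂ] ℂ) (A : V →ₗ[ℂ] V) (w : F ⊗[ℂ] V) :
    TensorProduct.lid ℂ V (LinearMap.rTensor V μ (LinearMap.lTensor F A w)) =
      A (TensorProduct.lid ℂ V (LinearMap.rTensor V μ w)) := by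
  induction w using TensorProduct.induction_on with
  | zero => simp
  | tmul f v => simp
  | add x y hx hy => simp only [map_add, hx, hy]

theorem Representation.IsIrreducible.exists_smul_eq {H V : Type*} [Group H] [AddCommGroup V]
    [Module ℂ V] [FiniteDimensional ℂ V] {ρ : Representation ℂ H V} (hρ : ρ.IsIrreducible)
    (f : V →ₗ[ℂ] V) (hf : ∀ h v, f (ρ h v) = ρ h (f v)) : ∃ s : ℂ, ∀ v, f v = s • v := by
  let f' : Representation.IntertwiningMap ρ ρ := f.intertwiningMap_of_isIntertwiningMap ρ ρ hf
  have := hρ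
  obtain ⟨s, hs⟩ :=
    (algebraMap_intertwiningMap_bijective_of_isAlgClosed (k := ℂ) (ρ := ρ)).2 f'
  refine ⟨s, fun v => ?_⟩
  have h := congrArg (fun k : Representation.IntertwiningMap ρ ρ => k v) hs
  exact h.symm

theorem Representation.IsIrreducible.eq_zero_of_forall_apply_eq {H V : Type*} [Group H]
    [AddCommGroup V] [Module ℂ V] {ρ : Representation ℂ H V} (hρ : ρ.IsIrreducible)
    (hnt : ∃ h, ρ h ≠ 1) {v : V} (hv : ∀ h, ρ h v = v) : v = 0 := by
  let S : Subrepresentation ρ := ⟨ρ.invariants, fun h w hw => by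
    rw [hw h]
    exact hw⟩
  rcases hρ.eq_bot_or_eq_top S with h | h
  · have : v ∈ S := hv
    rw [h] at this
    exact this
  · obtain ⟨k, hk⟩ := hnt
    refine absurd (LinearMap.ext fun w => ?_) hk
    have : w ∈ S := by rw [h]; trivial
    exact this k

theorem Representation.IsIrreducible.exists_dual_eq_one {H V : Type*} [Group H] [AddCommGroup V]
    [Module ℂ V] {ρ : Representation ℂ H V} (hρ : ρ.IsIrreducible) :
    ∃ (v : V) (l : V →ₗ[ℂ] ℂ), l v = 1 := by
  have : Nontrivial V := by
    by_contra hV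
    rw [not_nontrivial_iff_subsingleton] at hV
    exact hρ.toNontrivial.exists_pair_ne.elim fun S ⟨T, hST⟩ => hST (SetLike.ext fun v => by
      rw [Subsingleton.elim v 0]
      exact ⟨fun _ => T.toSubmodule.zero_mem, fun _ => S.toSubmodule.zero_mem⟩)
  let b := Module.Basis.ofVectorSpace ℂ V
  obtain ⟨i⟩ := b.index_nonempty
  exact ⟨b i, b.coord i, by simp⟩

section Intertwiners

variable {G : Type u} [Group G] {H : Subgroup G} {V : Type u} [NormedAddCommGroup V]
  [InnerProductSpace ℂ V] {ρ : Representation ℂ H V}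
  {F : Type u} [NormedAddCommGroup F] [InnerProductSpace ℂ F]

/-- The endomorphism of `F` obtained from one of `F ⊗ V` by contraction with `v : V` and a linear
form `l` on `V`. If `l v = 1`, it maps `B ⊗ id` to `B`. -/
noncomputable def contractEnd (v : V) (l : V →ₗ[ℂ] ℂ) (A : (F ⊗[ℂ] V) →ₗ[ℂ] F ⊗[ℂ] V) :
    F →ₗ[ℂ] F :=
  (TensorProduct.rid ℂ F).toLinearMap ∘ₗ LinearMap.lTensor F l ∘ₗ A ∘ₗ
    (TensorProduct.mk ℂ F V).flip v

theorem contractEnd_apply (v : V) (l : V →ₗ[ℂ] ℂ) (A : (F ⊗[ℂ] V) →ₗ[ℂ] F ⊗[ℂ] V) (f : F) :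
    contractEnd v l A f = TensorProduct.rid ℂ F (LinearMap.lTensor F l (A (f ⊗ₜ v))) := rfl

/-- An endomorphism of `F ⊗ V` which commutes with `H` has the form `B ⊗ id`: by Schur's lemma
each of its partial matrix coefficients with respect to `F` is a scalar. -/
theorem Representation.IsIrreducible.apply_tmul_eq_contractEnd [FiniteDimensional ℂ V]
    (hρ : ρ.IsIrreducible) {v₀ : V} {l : V →ₗ[ℂ] ℂ} (hl : l v₀ = 1)
    {A : (F ⊗[ℂ] V) →ₗ[ℂ] F ⊗[ℂ] V}
    (hA : ∀ h w, A (LinearMap.lTensor F (ρ h) w) = LinearMap.lTensor F (ρ h) (A w))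
    (f : F) (v : V) : A (f ⊗ₜ v) = contractEnd v₀ l A f ⊗ₜ v := by
  rw [← sub_eq_zero]
  refine TensorProduct.eq_zero_of_forall_dual fun μ => ?_
  rw [map_sub, map_sub, sub_eq_zero]
  let κ : (F ⊗[ℂ] V) →ₗ[ℂ] V := (_root_.TensorProduct.lid ℂ V).toLinearMap ∘ₗ LinearMap.rTensor V μ
  have hκ : ∀ h w, κ (LinearMap.lTensor F (ρ h) w) = ρ h (κ w) := fun h w =>
    _root_.TensorProduct.lid_rTensor_lTensor μ (ρ h) w
  have hlκ : ∀ w, l (κ w) = μ (_root_.TensorProduct.rid ℂ F (LinearMap.lTensor F l w)) := by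
    intro w
    induction w using TensorProduct.induction_on with
    | zero => simp
    | tmul f v => simp [κ, mul_comm]
    | add x y hx hy => simp only [map_add, hx, hy]
  obtain ⟨s, hs⟩ := hρ.exists_smul_eq (κ ∘ₗ A ∘ₗ TensorProduct.mk ℂ F V f) fun h v => by
    simp only [LinearMap.comp_apply, TensorProduct.mk_apply]
    rw [← hκ, ← hA, LinearMap.lTensor_tmul]
  have hs' : ∀ v, κ (A (f ⊗ₜ v)) = s • v := hs
  change κ (A (f ⊗ₜ v)) = κ (_ ⊗ₜ v)
  have h1 : κ (contractEnd v₀ l A f ⊗ₜ v) = μ (contractEnd v₀ l A f) • v := by simp [κ]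
  rw [h1, contractEnd_apply, ← hlκ, hs', hs', map_smul, hl, smul_eq_mul, mul_one]

/-- If `ρ` is equivalent to its conjugates, the representation of `H` on the fibre of the canonical
model over each `c` is equivalent to `id ⊗ ρ`. -/
theorem RightRetraction.exists_intertwiner (r : RightRetraction H) [H.Normal]
    (hconj : ∀ g : G, ∃ C : V ≃ₗ[ℂ] V, ∀ (h h' : H), (h' : G) = g⁻¹ * h * g →
      ∀ v : V, ρ h' (C v) = C (ρ h v)) (c : G ⧸ H) :
    ∃ C : V ≃ₗ[ℂ] V, ∀ (h : H) (v : V), ρ (r.cocycle h c) (C v) = C (ρ h v) := by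
  induction c using QuotientGroup.induction_on with
  | H g =>
    obtain ⟨C, hC⟩ := hconj g
    refine ⟨C.trans
      { ρ (r.toFun g) with
        invFun := ρ (r.toFun g)⁻¹
        left_inv := fun v => ρ.inv_self_apply _ v
        right_inv := fun v => ρ.self_inv_apply _ v }, fun h v => ?_⟩
    change ρ _ (ρ (r.toFun g) (C v)) = ρ (r.toFun g) (C (ρ h v))
    have hmem : g⁻¹ * h * g ∈ H := by
      simpa using (inferInstance : H.Normal).conj_mem (h : G) h.2 g⁻¹
    have hr : r.toFun (h * g) = r.toFun g * ⟨g⁻¹ * h * g, hmem⟩ := by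
      rw [← r.map_mul]
      congr 1
      group
    rw [← hC h ⟨g⁻¹ * h * g, hmem⟩ rfl, RightRetraction.cocycle_mk, hr, ← Module.End.mul_apply,
      ← Module.End.mul_apply, ← _root_.map_mul, ← _root_.map_mul, inv_mul_cancel_right]

end Intertwiners

/-! ### Morphisms and transition functions of principal bundles -/

namespace PrincipalBundle

variable {L : Type u} [Group L] [TopologicalSpace L] {X : Type u} [TopologicalSpace X]

/-- Every morphism `f` of principal bundles is invertible: it is bijective as the action is simply
transitive on the fibres, and in terms of the sections `sec` the inverse is given by
`a • f (sec y) ↦ a • sec y`. -/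
theorem isIso_of_continuousInv [ContinuousInv L] {P Q : PrincipalBundle L X} (f : P ⟶ Q) :
    IsIso f := by
  have hinj : Function.Injective f.toFun := by
    intro p q h
    have hpq : P.proj p = P.proj q := by rw [← f.proj_toFun, h, f.proj_toFun]
    obtain ⟨a, rfl⟩ := exists_smul_eq hpq
    rw [f.map_smul, eq_comm] at h
    nth_rw 2 [← one_smul L (f.toFun p)] at h
    rw [smul_right_cancel h, one_smul]
  have hsurj : ∀ q : Q.Total, ∃ p : P.Total, f.toFun p = q := by
    intro q
    have hq : Q.proj (f.toFun (P.sec (Q.proj q) (Q.proj q))) = Q.proj q := by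
      rw [f.proj_toFun, proj_sec (P.mem_chart _)]
    obtain ⟨a, ha⟩ := exists_smul_eq hq
    exact ⟨a • P.sec (Q.proj q) (Q.proj q), by rw [f.map_smul, ha]⟩
  choose k hk using hsurj
  have hkp : ∀ q, P.proj (k q) = Q.proj q := fun q => by rw [← f.proj_toFun, hk]
  have hcont : Continuous k := by
    rw [continuous_iff_continuousAt]
    intro q₀
    let x := Q.proj q₀
    let U : Set X := (P.chart x).baseSet ∩ (Q.chart x).baseSet
    have hU : IsOpen (Q.proj ⁻¹' U) :=
      ((P.chart x).open_baseSet.inter (Q.chart x).open_baseSet).preimage continuous_proj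
    refine ContinuousOn.continuousAt ?_ (hU.mem_nhds ⟨P.mem_chart x, Q.mem_chart x⟩)
    have hs : ContinuousOn (fun q => P.sec x (Q.proj q)) (Q.proj ⁻¹' U) :=
      continuousOn_sec.comp continuous_proj.continuousOn fun q hq => hq.1
    have hfs : ContinuousOn (fun q => Q.coord x (f.toFun (P.sec x (Q.proj q)))) (Q.proj ⁻¹' U) :=
      continuousOn_coord.comp (f.continuous_toFun.comp_continuousOn hs) fun q hq => by
        rw [Set.mem_preimage, f.proj_toFun, proj_sec hq.1]
        exact hq.2
    have hc : ContinuousOn (Q.coord x) (Q.proj ⁻¹' U) :=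
      continuousOn_coord.mono fun q hq => hq.2
    refine (hc.smul (hfs.inv.smul hs)).congr fun q hq => hinj ?_
    have hp : Q.proj (f.toFun (P.sec x (Q.proj q))) = Q.proj q := by
      rw [f.proj_toFun, proj_sec hq.1]
    change f.toFun (k q) = f.toFun (Q.coord x q •
      (Q.coord x (f.toFun (P.sec x (Q.proj q))))⁻¹ • P.sec x (Q.proj q))
    rw [hk, f.map_smul, f.map_smul]
    refine eq_of_coord_eq (x := x) hq.2 ?_ ?_
    · rw [Q.proj_smul, Q.proj_smul, hp]
    · have h1 : Q.proj (f.toFun (P.sec x (Q.proj q))) ∈ (Q.chart x).baseSet := hp.symm ▸ hq.2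
      rw [coord_smul (by rwa [Q.proj_smul]), coord_smul h1, inv_mul_cancel, mul_one]
  exact ⟨⟨k, hcont, fun a q => hinj (by rw [hk, f.map_smul, hk]), hkp⟩,
    Hom.ext (funext fun p => hinj (hk _)), Hom.ext (funext hk)⟩

variable (P : PrincipalBundle L X) {x x' x'' y : X}

/-- The transition function between the chosen trivializations around `x` and `x'`, normalized by
`sec x' y = transition x x' y • sec x y`. -/
noncomputable def transition (x x' y : X) : L := P.coord x (P.sec x' y)

variable {P}

theorem transition_self (hy : y ∈ (P.chart x).baseSet) : P.transition x x y = 1 := coord_sec hy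

theorem transition_mul (hy : y ∈ (P.chart x).baseSet) (hy' : y ∈ (P.chart x').baseSet)
    (hy'' : y ∈ (P.chart x'').baseSet) :
    P.transition x' x'' y * P.transition x x' y = P.transition x x'' y := by
  have h := coord_smul_sec (P := P) (x := x') (p := P.sec x'' y) (by rwa [proj_sec hy''])
  rw [proj_sec hy''] at h
  rw [transition, transition, transition, ← coord_smul (by rwa [proj_sec hy']), h]

theorem coord_mul_transition {p : P.Total} (hx : P.proj p ∈ (P.chart x).baseSet)
    (hx' : P.proj p ∈ (P.chart x').baseSet) :
    P.coord x' p * P.transition x x' (P.proj p) = P.coord x p := by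
  rw [transition, ← coord_smul (by rwa [proj_sec hx']), coord_smul_sec hx']

theorem continuousOn_transition :
    ContinuousOn (P.transition x x') ((P.chart x).baseSet ∩ (P.chart x').baseSet) :=
  continuousOn_coord.comp (continuousOn_sec.mono Set.inter_subset_right) fun y hy => by
    rw [Set.mem_preimage, proj_sec hy.2]
    exact hy.1

end PrincipalBundle

/-! ### The associated bundles -/

section Associated

open Bundle

attribute [local instance] AutModel.discreteTopology_quotient

variable {G : Type u} [Group G] {H : Subgroup G} [TopologicalSpace G]
  {V : Type u} [NormedAddCommGroup V] [InnerProductSpace ℂ V]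
  {r : RightRetraction H} {ρ : Representation ℂ H V}
  {F : Type u} [NormedAddCommGroup F] [InnerProductSpace ℂ F]
  {X : Type u} [TopologicalSpace X]

namespace PrincipalBundle

variable [DiscreteTopology G] [FiniteDimensional ℂ V] [FiniteDimensional ℂ F]
  (P : PrincipalBundle (AutModel r ρ F) X)

/-- Gluing data for `M = P ×_{Aut_G(W)} (G ⧸ H)`, with one trivialization for each `x : X`. -/
noncomputable def baseCore : FiberBundleCore X X (G ⧸ H) where
  baseSet x := (P.chart x).baseSet
  isOpen_baseSet x := (P.chart x).open_baseSet
  indexAt x := x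
  mem_baseSet_at x := P.mem_chart x
  coordChange x x' y c := AutModel.base (P.transition x x' y) c
  coordChange_self x y hy c := by rw [transition_self hy, AutModel.base_one]
  continuousOn_coordChange x x' := by
    have h := AutModel.continuousOn_apply
      (f := fun q : X × (G ⧸ H) => P.transition x x' q.1) (x := fun q => (q.2, 0))
      (s := ((P.chart x).baseSet ∩ (P.chart x').baseSet) ×ˢ Set.univ)
      (continuousOn_transition.comp continuous_fst.continuousOn fun q hq => hq.1)
      (continuous_snd.prodMk continuous_const).continuousOn
    refine (continuous_fst.comp_continuousOn h).congr fun q _ => ?_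
    simp only [Function.comp_apply, AutModel.apply_mk]
  coordChange_comp x x' x'' y hy c := by
    rw [← AutModel.base_mul, transition_mul hy.1.1 hy.1.2 hy.2]

/-- The element of `G ⧸ H` representing a point `m` of `M` in the trivialization around its own
projection to `X`. -/
def rep (m : P.baseCore.TotalSpace) : G ⧸ H := m.2

/-- The coordinate of a point of `M` in the trivialization around `x`. -/
noncomputable def baseCoord (x : X) (m : P.baseCore.TotalSpace) : G ⧸ H :=
  AutModel.base (P.transition m.1 x m.1) (P.rep m)

theorem continuousOn_baseCoord (x : X) :
    ContinuousOn (P.baseCoord x) (TotalSpace.proj ⁻¹' (P.chart x).baseSet) :=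
  continuous_snd.comp_continuousOn (P.baseCore.localTriv x).continuousOn_toFun

theorem continuous_toBase {T : Type*} [TopologicalSpace T] {f : T → P.baseCore.TotalSpace}
    (hf : Continuous fun t => (f t).proj)
    (h : ∀ x, ContinuousOn (fun t => P.baseCoord x (f t))
      ((fun t => (f t).proj) ⁻¹' (P.chart x).baseSet)) : Continuous f :=
  Trivialization.continuous_of_comp P.baseCore.localTriv (fun x => ⟨x, P.mem_chart x⟩) hf h

theorem baseCoord_self (m : P.baseCore.TotalSpace) : P.baseCoord m.1 m = P.rep m := by
  rw [baseCoord, transition_self (P.mem_chart _), AutModel.base_one]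

theorem base_transition_baseCoord {x x' : X} {m : P.baseCore.TotalSpace}
    (hx : m.1 ∈ (P.chart x).baseSet) (hx' : m.1 ∈ (P.chart x').baseSet) :
    AutModel.base (P.transition x x' m.1) (P.baseCoord x m) = P.baseCoord x' m := by
  rw [baseCoord, ← AutModel.base_mul, transition_mul (P.mem_chart _) hx hx', baseCoord]

variable [H.Normal]

/-- `G ⧸ H` acts on `M` by left translations, which commute with the right translations induced by
`Aut_G(W)`. -/
noncomputable instance : MulAction (G ⧸ H) P.baseCore.TotalSpace where
  smul d m := ⟨m.1, d * P.rep m⟩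
  one_smul m := congrArg (TotalSpace.mk m.1) (one_mul (P.rep m))
  mul_smul d d' m := congrArg (TotalSpace.mk m.1) (mul_assoc d d' (P.rep m))

theorem baseCoord_smul (x : X) (d : G ⧸ H) (m : P.baseCore.TotalSpace) :
    P.baseCoord x (d • m) = d * P.baseCoord x m := by
  change AutModel.base _ (d * P.rep m) = d * AutModel.base _ (P.rep m)
  rw [AutModel.base_eq_mul, AutModel.base_eq_mul _ (P.rep m), mul_assoc]
  rfl

/-- The principal `G ⧸ H`-bundle `M = P ×_{Aut_G(W)} (G ⧸ H)`. -/
noncomputable def quotientBundle : PrincipalBundle (G ⧸ H) X where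
  Total := P.baseCore.TotalSpace
  continuousAction := ⟨continuous_prod_of_discrete_left.2 fun d =>
    P.continuous_toBase P.baseCore.continuous_proj fun x => by
      refine ((continuous_of_discreteTopology (f := fun c => d * c)).comp_continuousOn
        (P.continuousOn_baseCoord x)).congr fun m _ => ?_
      exact P.baseCoord_smul x d m⟩
  proj := TotalSpace.proj
  proj_smul _ _ := rfl
  locallyTrivial x := ⟨P.baseCore.localTriv x, P.mem_chart x, fun m _ d => P.baseCoord_smul x d m⟩

end PrincipalBundle

/-- A continuous family of linear maps `T a c` of `K` over the action of the automorphisms `a` of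
the canonical model on the points `c` of `G ⧸ H`, with the cocycle property: equivalently, an
action of the automorphism group on the bundle `(G ⧸ H) × K` over `G ⧸ H`. -/
structure LinearCocycle (r : RightRetraction H) (ρ : Representation ℂ H V)
    (F : Type u) [NormedAddCommGroup F] [InnerProductSpace ℂ F]
    (K : Type u) [NormedAddCommGroup K] [NormedSpace ℂ K] where
  map : AutModel r ρ F → G ⧸ H → K →ₗ[ℂ] K
  map_one : ∀ c v, map 1 c v = v
  map_mul : ∀ a b c v, map (a * b) c v = map a (AutModel.base b c) (map b c v)
  continuous : ∀ c v, Continuous fun a => map a c v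

namespace LinearCocycle

variable [DiscreteTopology G] [FiniteDimensional ℂ V] [FiniteDimensional ℂ F]
  {K : Type u} [NormedAddCommGroup K] [NormedSpace ℂ K] [FiniteDimensional ℂ K]
  (T : LinearCocycle r ρ F K) (P : PrincipalBundle (AutModel r ρ F) X)

/-- Gluing data for the vector bundle `P ×_{Aut_G(W)} ((G ⧸ H) × K)` over `M`. -/
noncomputable def core : VectorBundleCore ℂ P.baseCore.TotalSpace K X where
  baseSet x := TotalSpace.proj ⁻¹' (P.chart x).baseSet
  isOpen_baseSet x := (P.chart x).open_baseSet.preimage P.baseCore.continuous_proj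
  indexAt m := m.1
  mem_baseSet_at m := P.mem_chart m.1
  coordChange x x' m := LinearMap.toContinuousLinearMap
    (T.map (P.transition x x' m.1) (P.baseCoord x m))
  coordChange_self x m hm v := by
    rw [PrincipalBundle.transition_self hm]
    exact T.map_one _ v
  continuousOn_coordChange x x' := by
    rw [continuousOn_clm_apply]
    intro v
    refine continuousOn_of_discrete_fibres
      ((P.continuousOn_baseCoord x).mono Set.inter_subset_left) fun c => ?_
    have h : ContinuousOn (fun m : P.baseCore.TotalSpace => T.map (P.transition x x' m.1) c v)
        (TotalSpace.proj ⁻¹' (P.chart x).baseSet ∩ TotalSpace.proj ⁻¹' (P.chart x').baseSet ∩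
          P.baseCoord x ⁻¹' {c}) :=
      (T.continuous c v).comp_continuousOn (PrincipalBundle.continuousOn_transition.comp
        P.baseCore.continuous_proj.continuousOn fun m hm => hm.1)
    refine h.congr ?_
    rintro m ⟨-, rfl⟩
    rfl
  coordChange_comp x x' x'' m hm v := by
    change T.map _ _ (T.map _ _ v) = T.map _ _ v
    rw [← P.base_transition_baseCoord hm.1.1 hm.1.2, ← T.map_mul,
      PrincipalBundle.transition_mul hm.1.1 hm.1.2 hm.2]

/-- The vector representing a point `z` of the associated vector bundle in the trivialization
around its own projection to `X`. -/
def vec (z : TotalSpace K (T.core P).Fiber) : K := z.2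

/-- The fibre coordinate of a point of the associated vector bundle in the trivialization
around `x`. -/
noncomputable def fibreCoord (x : X) (z : TotalSpace K (T.core P).Fiber) : K :=
  T.map (P.transition z.1.1 x z.1.1) (P.rep z.1) (T.vec P z)

theorem continuousOn_fibreCoord (x : X) :
    ContinuousOn (T.fibreCoord P x) ((fun z => z.proj.proj) ⁻¹' (P.chart x).baseSet) := by
  refine (continuous_snd.comp_continuousOn ((T.core P).localTriv x).continuousOn_toFun).congr
    fun z _ => ?_
  change _ = T.map (P.transition z.1.1 x z.1.1) (P.baseCoord z.1.1 z.1) (T.vec P z)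
  rw [P.baseCoord_self, fibreCoord]

theorem continuousOn_baseCoord_proj (x : X) :
    ContinuousOn (fun z : TotalSpace K (T.core P).Fiber => P.baseCoord x z.proj)
      ((fun z => z.proj.proj) ⁻¹' (P.chart x).baseSet) :=
  (P.continuousOn_baseCoord x).comp (T.core P).continuous_proj.continuousOn fun _ hz => hz

theorem continuous_toTotal {S : Type*} [TopologicalSpace S]
    {f : S → TotalSpace K (T.core P).Fiber} (hf : Continuous fun s => (f s).proj)
    (h : ∀ x, ContinuousOn (fun s => T.fibreCoord P x (f s))
      ((fun s => (f s).proj.proj) ⁻¹' (P.chart x).baseSet)) : Continuous f := by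
  refine Trivialization.continuous_of_comp (T.core P).localTriv
    (fun m => ⟨m.1, P.mem_chart m.1⟩) hf fun x => (h x).congr fun s _ => ?_
  change T.map (P.transition (f s).1.1 x (f s).1.1) (P.baseCoord (f s).1.1 (f s).1)
    (T.vec P (f s)) = _
  rw [P.baseCoord_self]
  rfl

end LinearCocycle

end Associated

/-! ### The associated pair of a principal bundle -/

section AssociatedPair

open Bundle

attribute [local instance] AutModel.discreteTopology_quotient

variable {G : Type u} [Group G] {H : Subgroup G}
  {V : Type u} [NormedAddCommGroup V] [InnerProductSpace ℂ V]
  {r : RightRetraction H} {ρ : Representation ℂ H V}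
  {F : Type u} [NormedAddCommGroup F] [InnerProductSpace ℂ F]

theorem coe_smul_quotient [H.Normal] (h : H) (c : G ⧸ H) : (h : G) • c = c := by
  rw [smul_eq_mk_mul, (QuotientGroup.eq_one_iff (h : G)).2 h.2, one_mul]

/-- Intertwiners between `ρ` and the action of `H` on the fibres of the canonical model. -/
structure Intertwiners (r : RightRetraction H) (ρ : Representation ℂ H V) where
  equiv : G ⧸ H → V ≃ₗ[ℂ] V
  intertwines : ∀ (c : G ⧸ H) (h : H) (v : V),
    ρ (r.cocycle h c) (equiv c v) = equiv c (ρ h v)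

namespace Intertwiners

variable (C : Intertwiners r ρ)

variable (F) in
/-- The intertwiner from `id ⊗ ρ` to the action of `H` on the fibre of the canonical model. -/
noncomputable def tensor (c : G ⧸ H) : (F ⊗[ℂ] V) ≃ₗ[ℂ] (F ⊗[ℂ] V) :=
  LinearEquiv.lTensor F (C.equiv c)

theorem tensor_tmul (c : G ⧸ H) (f : F) (v : V) : C.tensor F c (f ⊗ₜ v) = f ⊗ₜ C.equiv c v := rfl

theorem lTensor_tensor (c : G ⧸ H) (h : H) (w : F ⊗[ℂ] V) :
    LinearMap.lTensor F (ρ (r.cocycle h c)) (C.tensor F c w) =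
      C.tensor F c (LinearMap.lTensor F (ρ h) w) := by
  induction w using TensorProduct.induction_on with
  | zero => simp
  | tmul f v => simp [tensor_tmul, C.intertwines]
  | add x y hx hy => simp only [map_add, hx, hy]

/-- The linear part of an automorphism read through the intertwiners, which commutes with the
action `id ⊗ ρ` of `H`. -/
noncomputable def untwist (a : AutModel r ρ F) (c : G ⧸ H) : (F ⊗[ℂ] V) →ₗ[ℂ] F ⊗[ℂ] V :=
  ((C.tensor F c).trans
    ((AutModel.lin a c).trans (C.tensor F (AutModel.base a c)).symm)).toLinearMap

theorem tensor_untwist (a : AutModel r ρ F) (c : G ⧸ H) (w : F ⊗[ℂ] V) :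
    C.tensor F (AutModel.base a c) (C.untwist a c w) = AutModel.lin a c (C.tensor F c w) :=
  LinearEquiv.apply_symm_apply _ _

variable [H.Normal]

theorem untwist_lTensor (a : AutModel r ρ F) (c : G ⧸ H) (h : H) (w : F ⊗[ℂ] V) :
    C.untwist a c (LinearMap.lTensor F (ρ h) w) =
      LinearMap.lTensor F (ρ h) (C.untwist a c w) := by
  apply (C.tensor F (AutModel.base a c)).injective
  have h1 := AutModel.lin_lTensor a (h : G) c (C.tensor F c w)
  rw [coe_smul_quotient, lTensor_tensor] at h1
  rw [tensor_untwist, h1, ← lTensor_tensor, tensor_untwist]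

variable [FiniteDimensional ℂ V] {v₀ : V} {l : V →ₗ[ℂ] ℂ}

theorem untwist_tmul (hρ : ρ.IsIrreducible) (hl : l v₀ = 1) (a : AutModel r ρ F) (c : G ⧸ H)
    (f : F) (v : V) : C.untwist a c (f ⊗ₜ v) = contractEnd v₀ l (C.untwist a c) f ⊗ₜ v :=
  hρ.apply_tmul_eq_contractEnd hl (C.untwist_lTensor a c) f v

variable [TopologicalSpace G] [DiscreteTopology G]

/-- The action of automorphisms on the factor `F` of the fibres: untwisted by the intertwiners,
the linear part of an automorphism has the form `B ⊗ id`, and the cocycle consists of the maps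
`B`. -/
noncomputable def cocycle [FiniteDimensional ℂ F] (hρ : ρ.IsIrreducible) (hl : l v₀ = 1) :
    LinearCocycle r ρ F F where
  map a c := contractEnd v₀ l (C.untwist a c)
  map_one c f := by
    have h : C.untwist (1 : AutModel r ρ F) c (f ⊗ₜ v₀) = f ⊗ₜ v₀ := by
      apply (C.tensor F (AutModel.base (1 : AutModel r ρ F) c)).injective
      rw [tensor_untwist, AutModel.lin_one, AutModel.base_one]
    rw [contractEnd_apply, h]
    simp [hl]
  map_mul a b c f := by
    have h : C.untwist (a * b) c (f ⊗ₜ v₀) =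
        C.untwist a (AutModel.base b c) (C.untwist b c (f ⊗ₜ v₀)) := by
      apply (C.tensor F (AutModel.base (a * b) c)).injective
      rw [tensor_untwist, AutModel.lin_mul, ← tensor_untwist, ← tensor_untwist,
        AutModel.base_mul]
    rw [contractEnd_apply, h, C.untwist_tmul hρ hl b, contractEnd_apply v₀ l (C.untwist a _)]
  continuous c f := by
    rw [← continuousOn_univ]
    refine continuousOn_of_discrete_fibres (AutModel.continuous_base c).continuousOn fun d => ?_
    have h : Continuous fun a : AutModel r ρ F => TensorProduct.rid ℂ F (LinearMap.lTensor F l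
        ((C.tensor F d).symm (AutModel.lin a c (C.tensor F c (f ⊗ₜ v₀))))) :=
      (LinearMap.continuous_of_finiteDimensional ((TensorProduct.rid ℂ F).toLinearMap ∘ₗ
        LinearMap.lTensor F l ∘ₗ (C.tensor F d).symm.toLinearMap)).comp
        (AutModel.continuous_lin c _)
    refine h.continuousOn.congr ?_
    rintro a ⟨-, rfl⟩
    rfl

end Intertwiners

variable [TopologicalSpace G] {X : Type u} [TopologicalSpace X]

variable (r ρ F) in
/-- The action of automorphisms on the canonical model itself. -/
noncomputable def linCocycle : LinearCocycle r ρ F (F ⊗[ℂ] V) where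
  map a c := AutModel.lin a c
  map_one c v := AutModel.lin_one c v
  map_mul a b c v := AutModel.lin_mul a b c v
  continuous c v := AutModel.continuous_lin c v

theorem continuous_canonicalAction [DiscreteTopology G]
    [FiniteDimensional ℂ V] [FiniteDimensional ℂ F] (g : G) :
    Continuous (canonicalAction r ρ F g) :=
  continuous_prod_of_discrete_left.2 fun c =>
    Continuous.prodMk (continuous_const (y := g • c))
      (LinearMap.continuous_of_finiteDimensional (LinearMap.lTensor F (ρ (r.cocycle g c))))

namespace PrincipalBundle

variable [DiscreteTopology G] [FiniteDimensional ℂ V] [FiniteDimensional ℂ F]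
  (P : PrincipalBundle (AutModel r ρ F) X)

/-- The total space of the vector bundle `ξ = P ×_{Aut_G(W)} W` over `M`. -/
abbrev ModelTotal : Type u := TotalSpace (F ⊗[ℂ] V) ((linCocycle r ρ F).core P).Fiber

/-- The point of `ξ` over `x` represented by `w : W` in the trivialization around `x`. -/
noncomputable def ofModel (x : X) (w : (G ⧸ H) × (F ⊗[ℂ] V)) : P.ModelTotal := ⟨⟨x, w.1⟩, w.2⟩

/-- The point of `W` representing `z` in the trivialization around its own projection. -/
noncomputable def toModel (z : P.ModelTotal) : (G ⧸ H) × (F ⊗[ℂ] V) :=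
  (P.rep z.1, (linCocycle r ρ F).vec P z)

/-- The coordinate of a point of `ξ` in the trivialization around `x`. -/
noncomputable def modelCoord (x : X) (z : P.ModelTotal) : (G ⧸ H) × (F ⊗[ℂ] V) :=
  (P.transition z.1.1 x z.1.1).1 (P.toModel z)

theorem modelCoord_eq (x : X) (z : P.ModelTotal) :
    P.modelCoord x z = (P.baseCoord x z.1, (linCocycle r ρ F).fibreCoord P x z) :=
  AutModel.apply_eq _ _

theorem continuous_proj_modelTotal : Continuous fun z : P.ModelTotal => z.proj.proj :=
  P.baseCore.continuous_proj.comp ((linCocycle r ρ F).core P).continuous_proj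

theorem continuousOn_modelCoord (x : X) :
    ContinuousOn (P.modelCoord x) ((fun z => z.proj.proj) ⁻¹' (P.chart x).baseSet) :=
  (((linCocycle r ρ F).continuousOn_baseCoord_proj P x).prodMk
    ((linCocycle r ρ F).continuousOn_fibreCoord P x)).congr fun z _ => P.modelCoord_eq x z

theorem continuous_toModelTotal {T : Type*} [TopologicalSpace T] {f : T → P.ModelTotal}
    (hf : Continuous fun t => (f t).proj.proj)
    (h : ∀ x, ContinuousOn (fun t => P.modelCoord x (f t))
      ((fun t => (f t).proj.proj) ⁻¹' (P.chart x).baseSet)) : Continuous f := by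
  simp only [modelCoord_eq] at h
  exact (linCocycle r ρ F).continuous_toTotal P
    (P.continuous_toBase hf fun x => continuous_fst.comp_continuousOn (h x))
    fun x => continuous_snd.comp_continuousOn (h x)

/-- `G` acts on `ξ` through the canonical action on `W`, which commutes with `Aut_G(W)`. -/
noncomputable instance : MulAction G P.ModelTotal where
  smul g z := P.ofModel z.1.1 (canonicalAction r ρ F g (P.toModel z))
  one_smul z := congrArg (P.ofModel z.1.1) (canonicalAction_one r ρ F (P.toModel z))
  mul_smul g g' z := congrArg (P.ofModel z.1.1) (canonicalAction_mul r ρ F g g' (P.toModel z))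

theorem smul_ofModel (g : G) (x : X) (w : (G ⧸ H) × (F ⊗[ℂ] V)) :
    g • P.ofModel x w = P.ofModel x (canonicalAction r ρ F g w) := rfl

theorem modelCoord_smul (x : X) (g : G) (z : P.ModelTotal) :
    P.modelCoord x (g • z) = canonicalAction r ρ F g (P.modelCoord x z) :=
  AutModel.apply_canonicalAction _ g _

instance : ContinuousConstSMul G P.ModelTotal where
  continuous_const_smul g := P.continuous_toModelTotal P.continuous_proj_modelTotal fun x => by
    simp only [modelCoord_smul]
    exact (continuous_canonicalAction g).comp_continuousOn (P.continuousOn_modelCoord x)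

/-- Continuity of the isomorphism `ξ₀ ⊗ V ≅ ξ`: in the trivialization around `x` it is given, over
points `m` of `M` with coordinate `c`, by the intertwiner at `c`, and `c` is locally constant
in `m`. -/
theorem continuous_tensor (C : Intertwiners r ρ) (T : LinearCocycle r ρ F F)
    (hT : ∀ a c f v, C.untwist a c (f ⊗ₜ v) = T.map a c f ⊗ₜ v) (v : V) :
    Continuous fun e : TotalSpace F (T.core P).Fiber =>
      (⟨e.proj, C.tensor F (P.rep e.proj) (T.vec P e ⊗ₜ v)⟩ : P.ModelTotal) := by
  refine (linCocycle r ρ F).continuous_toTotal P (T.core P).continuous_proj fun x => ?_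
  have h : ContinuousOn (fun e : TotalSpace F (T.core P).Fiber =>
      C.tensor F (P.baseCoord x e.proj) (T.fibreCoord P x e ⊗ₜ v))
      ((fun e => e.proj.proj) ⁻¹' (P.chart x).baseSet) := by
    have hq := T.continuousOn_baseCoord_proj P x
    refine continuousOn_of_discrete_fibres hq fun c => ?_
    have hlin : Continuous fun f : F => C.tensor F c (f ⊗ₜ v) :=
      LinearMap.continuous_of_finiteDimensional
        ((C.tensor F c).toLinearMap ∘ₗ (TensorProduct.mk ℂ F V).flip v)
    refine (hlin.comp_continuousOn ((T.continuousOn_fibreCoord P x).mono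
      Set.inter_subset_left)).congr ?_
    rintro e ⟨-, rfl⟩
    rfl
  refine h.congr fun e _ => ?_
  have h1 := C.tensor_untwist (P.transition e.1.1 x e.1.1) (P.rep e.1)
    (T.vec P e ⊗ₜ[ℂ] v)
  rw [hT] at h1
  exact h1.symm

/-- The class of `(p, w)` in `P ×_{Aut_G(W)} W`: if `p = a • sec x` with `x` the projection of `p`,
it is represented by `a⁻¹ w` in the trivialization around `x`. -/
noncomputable def classOf (p : P.Total) (w : (G ⧸ H) × (F ⊗[ℂ] V)) : P.ModelTotal :=
  P.ofModel (P.proj p) ((P.coord (P.proj p) p)⁻¹.1 w)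

theorem modelCoord_classOf {x : X} {p : P.Total} (hx : P.proj p ∈ (P.chart x).baseSet)
    (w : (G ⧸ H) × (F ⊗[ℂ] V)) : P.modelCoord x (P.classOf p w) = (P.coord x p)⁻¹.1 w := by
  have h : (P.coord x p)⁻¹ =
      P.transition (P.proj p) x (P.proj p) * (P.coord (P.proj p) p)⁻¹ := by
    rw [← coord_mul_transition (P.mem_chart _) hx, mul_inv_rev, mul_inv_cancel_left]
  rw [h]
  rfl

theorem classOf_smul (a : AutModel r ρ F) (p : P.Total) (w : (G ⧸ H) × (F ⊗[ℂ] V)) :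
    P.classOf (a • p) w = P.classOf p (a⁻¹.1 w) := by
  rw [classOf, classOf, P.proj_smul, coord_smul (P.mem_chart _), mul_inv_rev]
  rfl

variable [H.Normal]

theorem smul_ofModel_tensor (C : Intertwiners r ρ) (h : H) (x : X) (c : G ⧸ H) (f : F) (v : V) :
    (h : G) • P.ofModel x (c, C.tensor F c (f ⊗ₜ v)) =
      P.ofModel x (c, C.tensor F c (f ⊗ₜ ρ h v)) := by
  rw [smul_ofModel]
  simp only [canonicalAction, coe_smul_quotient, C.lTensor_tensor, LinearMap.lTensor_tmul]

/-- The vector bundle `ξ = P ×_{Aut_G(W)} W` over `M`, where `ξ₀` is obtained from the action of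
`Aut_G(W)` on the factor `F`. -/
noncomputable def modelBundle (hρ : ρ.IsIrreducible) (C : Intertwiners r ρ) {v₀ : V}
    {l : V →ₗ[ℂ] ℂ} (hl : l v₀ = 1) : EquivariantBundle ρ F P.quotientBundle.Total where
  E := ((linCocycle r ρ F).core P).Fiber
  addCommGroup m := ((linCocycle r ρ F).core P).addCommGroupFiber m
  module m := ((linCocycle r ρ F).core P).moduleFiber m
  topFibre m := ((linCocycle r ρ F).core P).topologicalSpaceFiber m
  topTotal := ((linCocycle r ρ F).core P).toTopologicalSpace
  fiberBundle := ((linCocycle r ρ F).core P).fiberBundle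
  vectorBundle := ((linCocycle r ρ F).core P).vectorBundle
  action := inferInstanceAs (MulAction G P.ModelTotal)
  continuousAction := inferInstanceAs (ContinuousConstSMul G P.ModelTotal)
  linear g m := ⟨(LinearMap.lTensor F (ρ (r.cocycle g (P.rep m))) :
      (F ⊗[ℂ] V) →ₗ[ℂ] (F ⊗[ℂ] V)), fun v =>
    congrArg (fun c => P.ofModel (TotalSpace.proj m)
      (c, LinearMap.lTensor F (ρ (r.cocycle g (P.rep m))) v)) (smul_eq_mk_mul g (P.rep m))⟩
  free c m h := PrincipalBundle.smul_right_cancel (P := P.quotientBundle)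
    (h.trans (one_smul _ m).symm)
  fixed hnt m v hv := by
    have h1 : ∀ h : H, LinearMap.lTensor F (ρ (r.cocycle h (P.rep m))) v = v := fun h =>
      congrArg (fun z : P.ModelTotal => (P.toModel z).2) (hv h)
    obtain ⟨w, rfl⟩ : ∃ w : F ⊗[ℂ] V, C.tensor F (P.rep m) w = v :=
      (C.tensor F (P.rep m)).surjective v
    -- After applying the intertwiner, `w` is fixed by `id ⊗ ρ`; its contractions with linear forms
    -- on `F` are then fixed by `ρ`, hence zero.
    have h2 : ∀ h : H, LinearMap.lTensor F (ρ h) w = w := fun h => by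
      apply (C.tensor F (P.rep m)).injective
      rw [← C.lTensor_tensor, h1]
    have h3 : w = 0 := by
      refine TensorProduct.eq_zero_of_forall_dual fun μ => ?_
      refine hρ.eq_zero_of_forall_apply_eq hnt fun h => ?_
      rw [← TensorProduct.lid_rTensor_lTensor, h2]
    rw [h3, map_zero]
    rfl
  tensor := by
    let T := C.cocycle (F := F) hρ hl
    refine ⟨(T.core P).Fiber, (T.core P).addCommGroupFiber, (T.core P).moduleFiber,
      (T.core P).topologicalSpaceFiber, (T.core P).toTopologicalSpace, (T.core P).fiberBundle,
      (T.core P).vectorBundle, fun m => C.tensor F (P.rep m), fun v => ?_, fun h m f v => ?_⟩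
    · exact P.continuous_tensor C T (C.untwist_tmul hρ hl) v
    · exact P.smul_ofModel_tensor C h (TotalSpace.proj m) (P.rep m) f v

/-- The pair `(M, ξ)` associated with `P`. -/
noncomputable def modelPair (hρ : ρ.IsIrreducible) (C : Intertwiners r ρ) {v₀ : V}
    {l : V →ₗ[ℂ] ℂ} (hl : l v₀ = 1) : BundlePair ρ F X where
  M := P.quotientBundle
  ξ := P.modelBundle hρ C hl

theorem continuous_classOf (w : (G ⧸ H) × (F ⊗[ℂ] V)) : Continuous fun p => P.classOf p w := by
  refine P.continuous_toModelTotal continuous_proj fun x => ?_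
  have h := AutModel.continuousOn_iff.1
    (AutModel.continuousOn_inv (P.continuousOn_coord (x := x))) w
  exact h.congr fun p hp => P.modelCoord_classOf hp w

/-- The frame of the associated pair given by a point of `P`. -/
noncomputable def modelFrame (hρ : ρ.IsIrreducible) (C : Intertwiners r ρ) {v₀ : V}
    {l : V →ₗ[ℂ] ℂ} (hl : l v₀ = 1) (p : P.Total) : Frame r (P.modelPair hρ C hl) where
  toFun := P.classOf p
  equivariant g w := congrArg (P.ofModel _) (AutModel.apply_canonicalAction _ g w)
  proj_eq _ := rfl
  linear c := by
    let a := (P.coord (P.proj p) p)⁻¹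
    refine ⟨(⟨P.proj p, AutModel.base a c⟩ : P.baseCore.TotalSpace), AutModel.lin a c,
      fun w => ?_⟩
    exact congrArg (P.ofModel _) (AutModel.apply_mk a c w)

end PrincipalBundle

instance continuousInv_autModel [DiscreteTopology G] [FiniteDimensional ℂ V]
    [FiniteDimensional ℂ F] [H.Normal] : ContinuousInv (AutModel r ρ F) :=
  ⟨AutModel.continuous_inv⟩

/-- Every principal bundle `P` is the bundle of frames of the pair associated with it. -/
theorem essSurj_frameFunctor [DiscreteTopology G] [FiniteDimensional ℂ V] [FiniteDimensional ℂ F]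
    [H.Normal] (hρ : ρ.IsIrreducible) (C : Intertwiners r ρ) :
    (frameFunctor r ρ F X).EssSurj where
  mem_essImage P := by
    obtain ⟨v₀, l, hl⟩ := hρ.exists_dual_eq_one
    let f : P ⟶ (frameFunctor r ρ F X).obj (P.modelPair hρ C hl) :=
      { toFun := P.modelFrame hρ C hl
        continuous_toFun := by
          refine continuous_induced_rng.2 (continuous_pi fun w => ?_)
          exact P.continuous_classOf w
        map_smul := fun a p => Frame.ext (funext fun w => P.classOf_smul a p w)
        proj_toFun := fun _ => rfl }
    have := PrincipalBundle.isIso_of_continuousInv f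
    exact ⟨_, ⟨(asIso f).symm⟩⟩

end AssociatedPair

/-! ### The equivalence of categories -/

theorem mainTheorem2
    {G : Type u} [Group G] [TopologicalSpace G] [DiscreteTopology G]
    (H : Subgroup G) [H.Normal] [Finite H]
    {V : Type u} [NormedAddCommGroup V] [InnerProductSpace ℂ V] [FiniteDimensional ℂ V]
    (ρ : Representation ℂ H V) (hρ : ρ.IsIrreducible)
    (hconj : ∀ g : G, ∃ C : V ≃ₗ[ℂ] V, ∀ (h h' : H), (h' : G) = g⁻¹ * h * g →
      ∀ v : V, ρ h' (C v) = C (ρ h v))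
    (F : Type u) [NormedAddCommGroup F] [InnerProductSpace ℂ F] [FiniteDimensional ℂ F]
    (r : RightRetraction H)
    (X : Type u) [TopologicalSpace X] [CompactSpace X] :
    ∃ (e : PrincipalBundle (AutModel r ρ F) X ≌ BundlePair ρ F X)
      (ε : ∀ P : PrincipalBundle (AutModel r ρ F) X, Association P (e.functor.obj P)),
      ∀ (P Q : PrincipalBundle (AutModel r ρ F) X) (f : P ⟶ Q) (p : P.Total)
        (w : (G ⧸ H) × (F ⊗[ℂ] V)),
        (ε Q).toFun (f.toFun p) w = (e.functor.map f).toFun ((ε P).toFun p w) := by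
  choose C hC using r.exists_intertwiner hconj
  have := essSurj_frameFunctor (F := F) (X := X) (r := r) hρ ⟨C, hC⟩
  have : (frameFunctor r ρ F X).IsEquivalence := {}
  let e : PrincipalBundle (AutModel r ρ F) X ≌ BundlePair ρ F X :=
    (frameFunctor r ρ F X).asEquivalence.symm
  -- The unit identifies `P` with the bundle of frames of the pair `e.functor.obj P`, and `ε` is
  -- the evaluation of these frames.
  let η : ∀ P, P.Total → Frame r (e.functor.obj P) := fun P => (e.unit.app P).toFun
  have hη : ∀ P, Continuous (η P) := fun P => (e.unit.app P).continuous_toFun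
  have hηs : ∀ P (a : AutModel r ρ F) p, η P (a • p) = a • η P p := fun P =>
    (e.unit.app P).map_smul
  have hηp : ∀ P p, (η P p).point = P.proj p := fun P => (e.unit.app P).proj_toFun
  refine ⟨e, fun P =>
    { toFun := fun p w => (η P p).toFun w
      continuous_toFun := Frame.continuous_toFun_prod.comp
        (((hη P).comp continuous_fst).prodMk continuous_snd)
      smul_smul := fun a p w => by
        rw [hηs]
        exact Frame.smul_toFun_apply a (η P p) w
      equivariant := fun g p w => (η P p).equivariant g w
      proj_toFun := fun p w => ((η P p).proj_proj_toFun w).trans (hηp P p)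
      linear := fun p c => (η P p).linear c }, fun P Q f p w => ?_⟩
  have h := congrArg PrincipalBundle.Hom.toFun (e.unit.naturality f)
  exact congrFun (congrArg Frame.toFun (congrFun h p)) w
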